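/- Fix positive numbers $a_i$ ($i\in\mathbb N$) with $\sum_i a_i<\infty$. For $I\subseteq\mathbb N$ let $P_I\subseteq\ell^2$ be the closed linear span of $\{\mathbf e_i:i\in I\}$ ($P_\emptyset=\{0\}$); write $P_I$ also for the orthogonal projection onto it, and $\mathbf x_I$ for points of $P_I$. For $I\neq\emptyset$ let $\mu_I$ be the restriction to $P_I\subseteq\mathbb R^I$ of the product of the centred Gaussian laws with variances $a_i^2$, $i\in I$. For any $K\subseteq\mathbb N$ let $$C_K=\Big\{\mathbf x\in P_K:\ \sum_{i\in K}\Big|\ln\tfrac1{\sqrt{2\pi}\,a_i}-\tfrac{x_i^2}{2a_i^2}\Big|<\infty\Big\},\qquad F_K(\mathbf x)=\exp\sum_{i\in K}\Big(\ln\tfrac1{\sqrt{2\pi}\,a_i}-\tfrac{x_i^2}{2a_i^2}\Big)\quad(\mathbf x\in C_K).$$ For $I\ne\emptyset$ let $\Gamma_I$ be the set of all $I_1=(I\setminus K_1)\cup K_2$ with finite $K_1\subseteq I$, $K_2\subseteq\mathbb N\setminus I$, $|K_1|=|K_2|$. Let $S\subseteq\ell^2$ and $I\neq\emptyset$. A coordinate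 pairing $(S\cap U,P_{I_1})$ of $S$ consists of an open $U\subseteq\ell^2$ and $I_1\in\Gamma_I$ such that $P_{I_1}$ restricts to a homeomorphism of $S\cap U$ onto an open subset $U_{I_1}$ of $P_{I_1}$. $S$ is a surface of codimension $\Gamma_{\mathbb N\setminus I}$ if each of its points lies in $S\cap U$ for some coordinate pairing $(S\cap U,P_{I_1})$. A coordinate pairing is locally finite if $S\cap U=\{\mathbf x_{I_1}+f(\mathbf x_{I_1}):\mathbf x_{I_1}\in U_{I_1}\}$ for a Fréchet differentiable $f:U_{I_1}\to P_{\mathbb N\setminus I_1}$ with $f(U_{I_1})\subseteq C_{\mathbb N\setminus I_1}$ and $$\sup_{\mathbf x_{I_1}\in U_{I_1}} n_{I_1}(\mathbf x_{I_1}+f(\mathbf x_{I_1}))\,F_{\mathbb N\setminus I_1}(f(\mathbf x_{I_1}))<\infty,$$ where $$n_{I_1}(\mathbf x_{I_1}+f(\mathbf x_{I_1}))=\Big(1+\sum_{I_0\subseteq I_1,\ J_0\subseteq\mathbb N\setminus I_1,\ 1\le|I_0|=|J_0|<\infty}\big|\det\big(D_{x_j}f_i(\mathbf x_{I_1})\big)_{i\in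 J_0,\,j\in I_0}\big|^2\Big)^{1/2}\in[1,\infty].$$ For such a pairing and Borel $E\subseteq S\cap U$ put $$\mu(E,S\cap U,I_1,f)=\int_{P_{I_1}E} n_{I_1}(\mathbf x_{I_1}+f(\mathbf x_{I_1}))\,F_{\mathbb N\setminus I_1}(f(\mathbf x_{I_1}))\,d\mu_{I_1}(\mathbf x_{I_1}).$$ A measurable surface is a surface covered by locally finite coordinate pairings. Let $S$ be a surface of codimension $\Gamma_{\mathbb N\setminus I}$. (1) If $(S\cap U,P_{I_1})$ and $(S\cap U',P_{I_2})$ are locally finite coordinate pairings of $S$ with functions $f$ and $f'$, then $\mu(E,S\cap U,I_1,f)=\mu(E,S\cap U',I_2,f')$ for every Borel set $E\subseteq S\cap U\cap U'$. (2) If $S$ is a measurable surface and $\{(S\cap U_i,P_{I_i}):i\in\Lambda\}$ is a family of locally finite coordinate pairings of $S$, with functions $f_i$, that covers $S$, then there is a $\sigma$-finite Borel measure $\mu_S$ on $S$ such that $\mu_S(E)=\mu(E,S\cap U_i,I_i,f_i)$ for all $i\in\Lambda$ and all Borel $E\subseteq S\cap U_i$. -/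

import Mathlib

open MeasureTheory ProbabilityTheory
open scoped ENNReal

/-- The real Hilbert space `ℓ²` of square-summable sequences. -/
abbrev EllTwo : Type := lp (fun _ : ℕ => ℝ) 2

noncomputable instance instMeasurableSpaceEllTwo : MeasurableSpace EllTwo := borel EllTwo

instance instBorelSpaceEllTwo : BorelSpace EllTwo := ⟨rfl⟩

/-- The standard unit vector `e_i` of `ℓ²`. -/
noncomputable def stdVec (i : ℕ) : EllTwo := lp.single 2 i (1 : ℝ)

/-- `P_I`: the closed linear span of `{e_i : i ∈ I}` in `ℓ²` (it is `{0}` for `I = ∅`). -/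
noncomputable def coordSpace (I : Set ℕ) : Submodule ℝ EllTwo :=
  (Submodule.span ℝ (stdVec '' I)).topologicalClosure

instance instCompleteSpaceCoordSpace (I : Set ℕ) : CompleteSpace (coordSpace I) :=
  (Submodule.isClosed_topologicalClosure _).completeSpace_coe

/-- The orthogonal projection of `ℓ²` onto `P_I`. -/
noncomputable def coordProj (I : Set ℕ) : EllTwo →L[ℝ] coordSpace I :=
  (coordSpace I).orthogonalProjectionOnto

/-- The unit vector `e_i`, `i ∈ I`, as an element of `P_I`. -/
noncomputable def coordVec (I : Set ℕ) (i : I) : coordSpace I :=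
  ⟨stdVec i, Submodule.le_topologicalClosure _
    (Submodule.subset_span (Set.mem_image_of_mem stdVec i.2))⟩

/-- `I₁ ∼ I₂`: `I₂` arises from `I₁` by exchanging `k` elements of `I₁` for `k` elements outside
`I₁`, for some `k = 0, 1, 2, …`. -/
def IndexEquiv (I₁ I₂ : Set ℕ) : Prop :=
  ∃ K₁ K₂ : Finset ℕ, (K₁ : Set ℕ) ⊆ I₁ ∧ (K₂ : Set ℕ) ⊆ I₁ᶜ ∧ K₁.card = K₂.card ∧
    I₂ = (I₁ \ (K₁ : Set ℕ)) ∪ (K₂ : Set ℕ)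

/-- The class `Γ_I` of all index sets equivalent to `I`. -/
def indexClass (I : Set ℕ) : Set (Set ℕ) := {I₁ | IndexEquiv I I₁}

/-- `(S ∩ U, P_{I₁})` is a coordinate pairing of a set `S` of codimension `Γ_{ℕ∖I}`: `U` is open,
`I₁ ∈ Γ_I`, and `P_{I₁}` restricts to a homeomorphism of `S ∩ U` onto an open subset of `P_{I₁}`. -/
structure IsCoordinatePairing (I : Set ℕ) (S U : Set EllTwo) (I₁ : Set ℕ) : Prop where
  isOpen : IsOpen U
  mem_class : I₁ ∈ indexClass I
  homeo : Topology.IsOpenEmbedding ((S ∩ U).domRestrict (coordProj I₁))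

/-- `S` is a surface of `ℓ²` with codimension `Γ_{ℕ∖I}`. -/
def IsSurface (I : Set ℕ) (S : Set EllTwo) : Prop :=
  ∀ x ∈ S, ∃ (U : Set EllTwo) (I₁ : Set ℕ), x ∈ U ∧ IsCoordinatePairing I S U I₁

/-- The open set `U_{I₁} = P_{I₁}(S ∩ U)` of `P_{I₁}`. -/
def chartDomain (S U : Set EllTwo) (I₁ : Set ℕ) : Set (coordSpace I₁) :=
  coordProj I₁ '' (S ∩ U)

/-- The partial derivative `D_{x_j} f_i` at `x` of the `i`-th coordinate of `f`
(`i ∉ I`, `j ∈ I`). -/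
noncomputable def chartPartial {I : Set ℕ} (f : coordSpace I → coordSpace Iᶜ)
    (x : coordSpace I) (i : (Iᶜ : Set ℕ)) (j : I) : ℝ :=
  lineDeriv ℝ (fun y : coordSpace I => (f y : EllTwo) (i : ℕ)) x (coordVec I j)

/-- The pairs `(I₀, J₀)` of finite sets `I₀ ⊆ I`, `J₀ ⊆ ℕ∖I` with `|I₀| = |J₀| ≥ 1`. -/
abbrev MinorIndex (I : Set ℕ) : Type :=
  {p : Finset I × Finset (Iᶜ : Set ℕ) // p.1.card = p.2.card ∧ 1 ≤ p.1.card}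

/-- The minor `det (D_{x_j} f_i(x))`, `i ∈ J₀`, `j ∈ I₀` (both in increasing order). -/
noncomputable def chartMinor {I : Set ℕ} (f : coordSpace I → coordSpace Iᶜ)
    (x : coordSpace I) (p : MinorIndex I) : ℝ :=
  (Matrix.of fun k l : Fin p.1.1.card =>
    chartPartial f x (p.1.2.orderEmbOfFin p.2.1.symm k) (p.1.1.orderEmbOfFin rfl l)).det

/-- The area factor `n_I(x + f(x))`, i.e. the square root of `1 + ∑ |minor|²`, with values in
`[0, ∞]`. -/
noncomputable def areaFactor {I : Set ℕ} (f : coordSpace I → coordSpace Iᶜ)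
    (x : coordSpace I) : ℝ≥0∞ :=
  (1 + ∑' p : MinorIndex I, ENNReal.ofReal (|chartMinor f x p| ^ 2)) ^ (1 / 2 : ℝ)

/-- The logarithm of the density of the centred Gaussian law with variance `a_i²`, at `x_i`. -/
noncomputable def logDensity (a : ℕ → ℝ) (x : EllTwo) (i : ℕ) : ℝ :=
  Real.log (1 / (Real.sqrt (2 * Real.pi) * a i)) - x i ^ 2 / (2 * a i ^ 2)

/-- `C_I`: the points of `P_I` at which the product of the one-dimensional Gaussian densities
with indices in `I` converges (absolutely) in `(0, ∞)`. -/
def densityDomain (a : ℕ → ℝ) (I : Set ℕ) : Set (coordSpace I) :=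
  {x | Summable fun i : I => |logDensity a x i|}

/-- `F_I(x) = exp (∑_{i ∈ I} (log (1 / (√(2π) a_i)) - x_i² / (2 a_i²)))`, to be used on `C_I`. -/
noncomputable def density (a : ℕ → ℝ) (I : Set ℕ) (x : coordSpace I) : ℝ :=
  Real.exp (∑' i : I, logDensity a x i)

/-- `μ_I`: the product over `i ∈ I` of the centred Gaussian laws with variance `a_i²`, a measure on
`ℝ^I`, restricted to `P_I ⊆ ℝ^I`. The comap is along the measurable embedding `x ↦ (x_i)_{i ∈ I}`,
so that `μ_I(B)` is the product measure of the image of `B`. -/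
noncomputable def gaussMeasure (a : ℕ → ℝ) (I : Set ℕ) : Measure (coordSpace I) :=
  Measure.comap (fun (x : coordSpace I) (i : I) => (x : EllTwo) (i : ℕ))
    (Measure.infinitePi fun i : I => gaussianReal 0 (Real.toNNReal (a i ^ 2)))

/-- `(S ∩ U, P_{I₁})`, with the chart function `f : U_{I₁} → P_{ℕ∖I₁}`, is a locally finite
coordinate pairing of `S`. Only the values of `f` on `U_{I₁}` matter. -/
structure IsLocallyFinitePairing (a : ℕ → ℝ) (I : Set ℕ) (S U : Set EllTwo) (I₁ : Set ℕ)
    (f : coordSpace I₁ → coordSpace I₁ᶜ) : Prop where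
  pairing : IsCoordinatePairing I S U I₁
  graph : S ∩ U = (fun y : coordSpace I₁ => (y : EllTwo) + (f y : EllTwo)) '' chartDomain S U I₁
  differentiable : DifferentiableOn ℝ f (chartDomain S U I₁)
  mem_domain : ∀ y ∈ chartDomain S U I₁, f y ∈ densityDomain a I₁ᶜ
  bounded : ⨆ y ∈ chartDomain S U I₁,
    areaFactor f y * ENNReal.ofReal (density a I₁ᶜ (f y)) < ⊤

/-- `S` is a measurable surface of `ℓ²` with codimension `Γ_{ℕ∖I}`: a surface covered by locally
finite coordinate pairings. -/
def IsMeasurableSurface (a : ℕ → ℝ) (I : Set ℕ) (S : Set EllTwo) : Prop :=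
  IsSurface I S ∧ ∀ x ∈ S, ∃ (U : Set EllTwo) (I₁ : Set ℕ) (f : coordSpace I₁ → coordSpace I₁ᶜ),
    x ∈ U ∧ IsLocallyFinitePairing a I S U I₁ f

/-- The local surface measure
`μ(E, S ∩ U, I, f) = ∫_{P_I E} n_I(x + f(x)) F_{ℕ∖I}(f(x)) dμ_I(x)`. -/
noncomputable def localSurfaceMeasure (a : ℕ → ℝ) {I : Set ℕ} (f : coordSpace I → coordSpace Iᶜ)
    (E : Set EllTwo) : ℝ≥0∞ :=
  ∫⁻ x in coordProj I '' E, areaFactor f x * ENNReal.ofReal (density a Iᶜ (f x)) ∂(gaussMeasure a I)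

/-!
The local surface measures of two charts of `S` agree because, over the coordinates the charts
share, the passage from one to the other is a finite-dimensional change of variables.

Let the charts live over `P_{I₁}` and `P_{I₂}`. Both index sets arise from `I` by finitely many
exchanges, so they split over a common subset `L` with remainders of the same finite size `n`
(`exists_common_splitting`). The Gaussian measure on `P_{I₁}` is the product of that on `P_L` and
an explicit density on `ℝⁿ` (`lintegral_gaussMeasure_splitting`), and likewise for `I₂`. The
transition map keeps the component `z ∈ P_L`, and on the fibre over `z` it is an injective
differentiable map `ψ` between subsets of `ℝⁿ`. The change of variables formula, which needs no
continuity of the derivative, reduces the claim to a pointwise identity between the two integrands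
(`setLIntegral_fiber_eq`). That identity has two parts.

* The Gaussian densities in the `n` remaining coordinates complete `F_{ℕ∖I₁}` and `F_{ℕ∖I₂}` to the
  same number, `F_{ℕ∖L}` at the point of the surface (`prod_gaussianPDF_mul_density`).
* The area factors satisfy `n_{I₁} = |det ψ'| n_{I₂}` (`areaFactor_eq_mul`). The derivatives of the
  two chart functions have the same graph, the tangent space (`graphFrame_eq`). The square of the
  area factor is the sum over all `K` equivalent to `I` of the squared Plücker coordinates of this
  space, normalized to be `1` at `I₁` or at `I₂` (`areaFactor_eq_tsum_plucker`). Changing the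
  normalization multiplies all of them by the same determinant. For a fixed `K` only finitely many
  indices are involved, and this is multiplicativity of finite determinants.

The second claim follows by gluing the local measures along a countable subcover, which exists as
`ℓ²` is second countable; each of them is finite, because the integrand is bounded and the Gaussian
measure has mass at most `1`.
-/

/-! ### Coordinate subspaces of `ℓ²` -/

theorem stdVec_apply (i k : ℕ) : stdVec i k = if k = i then 1 else 0 := by
  rw [stdVec, lp.single_apply, Pi.single_apply]

theorem continuous_coord (i : ℕ) : Continuous fun x : EllTwo => x i :=
  (lp.evalCLM ℝ (fun _ : ℕ => ℝ) 2 i).continuous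

theorem sum_coord {κ : Type*} (s : Finset κ) (F : κ → EllTwo) (i : ℕ) :
    (∑ k ∈ s, F k : EllTwo) i = ∑ k ∈ s, F k i :=
  map_sum (lp.evalCLM ℝ (fun _ : ℕ => ℝ) 2 i) F s

theorem mem_coordSpace {I : Set ℕ} {x : EllTwo} : x ∈ coordSpace I ↔ ∀ i ∉ I, x i = 0 := by
  constructor
  · intro hx i hi
    have hle : coordSpace I ≤ LinearMap.ker (lp.evalCLM ℝ (fun _ : ℕ => ℝ) 2 i).toLinearMap := by
      refine Submodule.topologicalClosure_minimal _ ?_ ?_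
      · rw [Submodule.span_le]
        rintro _ ⟨j, hj, rfl⟩
        have : i ≠ j := fun h => hi (h ▸ hj)
        simp [stdVec_apply, this, lp.evalCLM]
      · exact (lp.evalCLM ℝ (fun _ : ℕ => ℝ) 2 i).isClosed_ker
    exact hle hx
  · intro hx
    have h := lp.hasSum_single (p := 2) (by simp) x
    refine (Submodule.isClosed_topologicalClosure _).mem_of_tendsto h
      (Filter.Eventually.of_forall fun s => ?_)
    refine Submodule.sum_mem _ fun i _ => ?_
    by_cases hi : i ∈ I
    · have : lp.single 2 i (x i) = x i • stdVec i := by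
        rw [stdVec, ← lp.single_smul]; simp
      rw [this]
      exact Submodule.smul_mem _ _ (coordVec I ⟨i, hi⟩).2
    · rw [hx i hi]
      simp

theorem coordProj_apply (I : Set ℕ) [DecidablePred (· ∈ I)] (x : EllTwo) (i : ℕ) :
    (coordProj I x : EllTwo) i = if i ∈ I then x i else 0 := by
  split_ifs with hi
  · have h := (coordSpace I).inner_orthogonalProjectionOnto_eq_of_mem_left (coordVec I ⟨i, hi⟩) x
    have e : ∀ y : EllTwo, inner ℝ (stdVec i) y = y i := fun y => by
      rw [stdVec, lp.inner_single_left]; simp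
    rw [← e x, ← e (coordProj I x)]
    exact h
  · exact mem_coordSpace.1 (coordProj I x).2 i hi

theorem coordProj_apply_of_mem {I : Set ℕ} {i : ℕ} (hi : i ∈ I) (x : EllTwo) :
    (coordProj I x : EllTwo) i = x i := by
  classical rw [coordProj_apply, if_pos hi]

theorem coordSpace_apply_of_notMem {I : Set ℕ} {i : ℕ} (hi : i ∉ I) (x : coordSpace I) :
    (x : EllTwo) i = 0 :=
  mem_coordSpace.1 x.2 i hi

theorem coordSpace_ext {I : Set ℕ} {x y : coordSpace I}
    (h : ∀ i ∈ I, (x : EllTwo) i = (y : EllTwo) i) : x = y := by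
  refine Subtype.ext (lp.ext (funext fun i => ?_))
  by_cases hi : i ∈ I
  · exact h i hi
  · rw [coordSpace_apply_of_notMem hi, coordSpace_apply_of_notMem hi]

theorem coordProj_coe {I : Set ℕ} (x : coordSpace I) : coordProj I (x : EllTwo) = x :=
  (coordSpace I).orthogonalProjectionOnto_mem_subspace_eq_self x

theorem coordVec_eq_coordProj {I : Set ℕ} (j : I) : coordVec I j = coordProj I (stdVec j) :=
  (coordProj_coe (coordVec I j)).symm

instance instSecondCountableTopologyEllTwo : SecondCountableTopology EllTwo := by
  have htop : coordSpace Set.univ = ⊤ := by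
    rw [eq_top_iff]; intro x _; exact mem_coordSpace.2 fun i hi => (hi trivial).elim
  have hs : TopologicalSpace.IsSeparable (coordSpace Set.univ : Set EllTwo) := by
    rw [coordSpace, Submodule.topologicalClosure_coe]
    exact (((Set.countable_univ.image stdVec).isSeparable).span).closure
  rw [htop, Submodule.top_coe, TopologicalSpace.isSeparable_univ_iff] at hs
  exact UniformSpace.secondCountable_of_separable _

/-- By the Lusin–Souslin theorem; hence `gaussMeasure`, defined as a `comap`, has no junk value. -/
theorem measurableEmbedding_coords (I : Set ℕ) :
    MeasurableEmbedding fun (x : coordSpace I) (i : I) => (x : EllTwo) (i : ℕ) := by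
  refine Continuous.measurableEmbedding ?_ ?_
  · exact continuous_pi fun i => (continuous_coord i).comp continuous_subtype_val
  · intro x y h
    exact coordSpace_ext fun i hi => congrFun h ⟨i, hi⟩

instance instIsFiniteMeasureGaussMeasure (a : ℕ → ℝ) (I : Set ℕ) :
    IsFiniteMeasure (gaussMeasure a I) := by
  refine ⟨?_⟩
  rw [gaussMeasure, (measurableEmbedding_coords I).comap_apply]
  exact measure_lt_top _ _

-- A shortcut: the general search from `IsFiniteMeasure` to `SFinite` times out on `coordSpace I`.
instance instSFiniteGaussMeasure (a : ℕ → ℝ) (I : Set ℕ) : SFinite (gaussMeasure a I) :=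
  have : SigmaFinite (gaussMeasure a I) :=
    @IsFiniteMeasure.toSigmaFinite _ _ _ (instIsFiniteMeasureGaussMeasure a I)
  @instSFiniteOfSigmaFinite _ _ _ this

theorem gaussMeasure_le_one (a : ℕ → ℝ) (I : Set ℕ) (B : Set (coordSpace I)) :
    gaussMeasure a I B ≤ 1 := by
  rw [gaussMeasure, (measurableEmbedding_coords I).comap_apply]
  exact prob_le_one

/-! ### Gaussian products and their disintegration -/

theorem pi_gaussianReal_eq_withDensity {κ : Type*} [Fintype κ] (v : κ → NNReal)
    (hv : ∀ k, v k ≠ 0) :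
    Measure.pi (fun k => gaussianReal 0 (v k)) =
      (volume : Measure (κ → ℝ)).withDensity fun u => ∏ k, gaussianPDF 0 (v k) (u k) := by
  symm
  refine (Measure.pi_eq (μ := fun k => gaussianReal 0 (v k)) fun s hs => ?_).symm
  have hbox : MeasurableSet (Set.univ.pi s) := MeasurableSet.univ_pi hs
  rw [withDensity_apply _ hbox, ← lintegral_indicator hbox]
  have hint : ∀ k, Integrable ((s k).indicator (gaussianPDFReal 0 (v k))) volume :=
    fun k => (integrable_gaussianPDFReal 0 (v k)).indicator (hs k)
  have hnn : ∀ k x, 0 ≤ (s k).indicator (gaussianPDFReal 0 (v k)) x := fun k x =>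
    Set.indicator_nonneg (fun x _ => gaussianPDFReal_nonneg _ _ _) x
  have hfun : ((Set.univ.pi s).indicator fun u : κ → ℝ => ∏ k, gaussianPDF 0 (v k) (u k)) =
      fun u => ENNReal.ofReal (∏ k, (s k).indicator (gaussianPDFReal 0 (v k)) (u k)) := by
    funext u
    rw [ENNReal.ofReal_prod_of_nonneg fun k _ => hnn k _]
    by_cases hu : u ∈ Set.univ.pi s
    · rw [Set.indicator_of_mem hu]
      refine Finset.prod_congr rfl fun k _ => ?_
      rw [Set.indicator_of_mem (hu k trivial), gaussianPDF_def]
    · rw [Set.indicator_of_notMem hu]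
      have : ∃ k, u k ∉ s k := by simpa using hu
      obtain ⟨k, hk⟩ := this
      exact (Finset.prod_eq_zero (Finset.mem_univ k) (by simp [hk])).symm
  rw [hfun, ← ofReal_integral_eq_lintegral_ofReal]
  · rw [volume_pi, integral_fintype_prod_eq_prod (𝕜 := ℝ)
      (fun k => (s k).indicator (gaussianPDFReal 0 (v k))),
      ENNReal.ofReal_prod_of_nonneg fun k _ => integral_nonneg (hnn k)]
    refine Finset.prod_congr rfl fun k _ => ?_
    rw [integral_indicator (hs k), gaussianReal_apply_eq_integral 0 (hv k)]
  · exact Integrable.fintype_prod (f := fun k => (s k).indicator (gaussianPDFReal 0 (v k))) hint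
  · exact Filter.Eventually.of_forall fun u => Finset.prod_nonneg fun k _ => hnn k _

/-- `I` is the disjoint union of `L` and of the range of the injective family `α`. -/
structure IsSplitting {κ : Type*} (L : Set ℕ) (α : κ → ℕ) (I : Set ℕ) : Prop where
  injective : Function.Injective α
  notMem : ∀ k, α k ∉ L
  eq_union : I = L ∪ Set.range α

namespace IsSplitting

variable {κ : Type*} {L I : Set ℕ} {α : κ → ℕ}

theorem left_mem (h : IsSplitting L α I) {i : ℕ} (hi : i ∈ L) : i ∈ I := by
  rw [h.eq_union]; exact Or.inl hi

theorem right_mem (h : IsSplitting L α I) (k : κ) : α k ∈ I := by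
  rw [h.eq_union]; exact Or.inr ⟨k, rfl⟩

theorem mem_cases (h : IsSplitting L α I) {i : ℕ} (hi : i ∈ I) : i ∈ L ∨ ∃ k, α k = i := by
  rw [h.eq_union] at hi; exact hi

/-- The bijection `L ⊕ κ ≃ I` of a splitting. -/
noncomputable def sumEquiv (h : IsSplitting L α I) : L ⊕ κ ≃ I :=
  Equiv.ofBijective
    (Sum.elim (fun l => ⟨l, h.left_mem l.2⟩) (fun k => ⟨α k, h.right_mem k⟩)) <| by
    constructor
    · rintro (l | k) (l' | k') hx
      · exact congrArg _ (Subtype.ext (congrArg (fun x : I => (x : ℕ)) hx))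
      · exact ((h.notMem k') (by
          have e : (l : ℕ) = α k' := congrArg (fun x : I => (x : ℕ)) hx
          exact e ▸ l.2)).elim
      · exact ((h.notMem k) (by
          have e : α k = (l' : ℕ) := congrArg (fun x : I => (x : ℕ)) hx
          exact e ▸ l'.2)).elim
      · exact congrArg _ (h.injective (congrArg (fun x : I => (x : ℕ)) hx))
    · rintro ⟨i, hi⟩
      rcases h.mem_cases hi with hl | ⟨k, rfl⟩
      · exact ⟨Sum.inl ⟨i, hl⟩, rfl⟩
      · exact ⟨Sum.inr k, rfl⟩

end IsSplitting

/-- The point of `P_I` with coordinates `z_i` at `i ∈ L` and `u_k` at `α k`, where `I` is split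
into `L` and the range of `α`. -/
noncomputable def coordJoin {κ : Type*} [Fintype κ] {L : Set ℕ} (α : κ → ℕ) (I : Set ℕ)
    (z : coordSpace L) (u : κ → ℝ) : coordSpace I :=
  coordProj I ((z : EllTwo) + ∑ k, u k • stdVec (α k))

section Join

variable {κ : Type*} [Fintype κ] {L I : Set ℕ} {α : κ → ℕ}

theorem coordJoin_apply_left (h : IsSplitting L α I) (z : coordSpace L) (u : κ → ℝ) {i : ℕ}
    (hi : i ∈ L) : (coordJoin α I z u : EllTwo) i = (z : EllTwo) i := by
  have hne : ∀ k, i ≠ α k := fun k e => h.notMem k (e ▸ hi)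
  rw [coordJoin, coordProj_apply_of_mem (h.left_mem hi)]
  rw [lp.coeFn_add, Pi.add_apply, sum_coord]
  simp [stdVec_apply, hne]

theorem coordJoin_apply_right (h : IsSplitting L α I) (z : coordSpace L) (u : κ → ℝ) (k : κ) :
    (coordJoin α I z u : EllTwo) (α k) = u k := by
  classical
  rw [coordJoin, coordProj_apply_of_mem (h.right_mem k)]
  rw [lp.coeFn_add, Pi.add_apply, sum_coord]
  simp [stdVec_apply, coordSpace_apply_of_notMem (h.notMem k), h.injective.eq_iff]

omit [Fintype κ] in
theorem coordSpace_ext_of_splitting (h : IsSplitting L α I) {x y : coordSpace I}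
    (hL : ∀ i ∈ L, (x : EllTwo) i = (y : EllTwo) i)
    (hα : ∀ k, (x : EllTwo) (α k) = (y : EllTwo) (α k)) : x = y := by
  refine coordSpace_ext fun i hi => ?_
  rcases h.mem_cases hi with hl | ⟨k, rfl⟩
  · exact hL i hl
  · exact hα k

theorem continuous_coordJoin :
    Continuous fun p : coordSpace L × (κ → ℝ) => coordJoin α I p.1 p.2 := by
  unfold coordJoin
  refine (coordProj I).continuous.comp ?_
  refine (continuous_subtype_val.comp continuous_fst).add ?_
  exact continuous_finsetSum _ fun k _ =>
    ((continuous_apply k).comp continuous_snd).smul continuous_const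

theorem infinitePi_prod_map_splitting (h : IsSplitting L α I) (m : ℕ → Measure ℝ)
    [∀ i, IsProbabilityMeasure (m i)] :
    ((Measure.infinitePi fun i : L => m i).prod (Measure.pi fun k => m (α k))).map
        (fun p (i : I) => Sum.elim p.1 p.2 (h.sumEquiv.symm i)) =
      Measure.infinitePi fun i : I => m i := by
  have hmeas : Measurable fun (p : (L → ℝ) × (κ → ℝ)) (i : I) =>
      (Sum.elim p.1 p.2 (h.sumEquiv.symm i) : ℝ) := by
    refine measurable_pi_lambda _ fun i => ?_
    rcases h.sumEquiv.symm i with l | k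
    · exact (measurable_pi_apply l).comp measurable_fst
    · exact (measurable_pi_apply k).comp measurable_snd
  refine Measure.eq_infinitePi _ fun s t ht => ?_
  rw [Measure.map_apply hmeas (.pi s.countable_toSet fun _ _ => ht _), ← Measure.infinitePi_eq_pi]
  set s' : Finset (L ⊕ κ) := s.map h.sumEquiv.symm.toEmbedding with hs'
  have hmem : ∀ q : L ⊕ κ, q ∈ s' ↔ h.sumEquiv q ∈ s := fun q => by
    simp [hs', Finset.mem_map_equiv]
  have hpre : (fun (p : (L → ℝ) × (κ → ℝ)) (i : I) =>
        (Sum.elim p.1 p.2 (h.sumEquiv.symm i) : ℝ)) ⁻¹' Set.pi s t =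
      Set.pi s'.toLeft (fun l => t (h.sumEquiv (Sum.inl l))) ×ˢ
        Set.pi s'.toRight (fun k => t (h.sumEquiv (Sum.inr k))) := by
    ext p
    simp only [Set.mem_preimage, Set.mem_pi, Set.mem_prod, Finset.mem_coe, Finset.mem_toLeft,
      Finset.mem_toRight, hmem]
    constructor
    · intro hp
      exact ⟨fun l hl => by simpa using hp _ hl, fun k hk => by simpa using hp _ hk⟩
    · rintro ⟨h1, h2⟩ i hi
      obtain ⟨q, rfl⟩ := h.sumEquiv.surjective i
      rw [Equiv.symm_apply_apply]
      rcases q with l | k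
      · exact h1 l hi
      · exact h2 k hi
  rw [hpre, Measure.prod_prod, Measure.infinitePi_pi _ fun _ _ => ht _,
    Measure.infinitePi_pi _ fun _ _ => ht _]
  have hs : s = s'.map h.sumEquiv.toEmbedding := by
    rw [hs', Finset.map_map]; ext; simp
  conv_rhs => rw [hs, ← Finset.toLeft_disjSum_toRight (u := s')]
  rw [Finset.prod_map, Finset.prod_disjSum]
  rfl

/-- The measure `μ_I` is the product of `μ_L` and of finitely many Gaussian laws. -/
theorem gaussMeasure_eq_map_prod (h : IsSplitting L α I) (a : ℕ → ℝ) :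
    gaussMeasure a I = ((gaussMeasure a L).prod
      (Measure.pi fun k => gaussianReal 0 (Real.toNNReal (a (α k) ^ 2)))).map
        (fun p => coordJoin α I p.1 p.2) := by
  set m : ℕ → Measure ℝ := fun i => gaussianReal 0 (Real.toNNReal (a i ^ 2)) with hm
  have eI := measurableEmbedding_coords I
  have eL := measurableEmbedding_coords L
  set jI := fun (x : coordSpace I) (i : I) => (x : EllTwo) (i : ℕ) with hjI
  set jL := fun (x : coordSpace L) (i : L) => (x : EllTwo) (i : ℕ) with hjL
  set θ := fun (p : (L → ℝ) × (κ → ℝ)) (i : I) => (Sum.elim p.1 p.2 (h.sumEquiv.symm i) : ℝ)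
    with hθdef
  have hθ : Measurable θ := by
    refine measurable_pi_lambda _ fun i => ?_
    simp only [hθdef]
    rcases h.sumEquiv.symm i with l | k
    · exact (measurable_pi_apply l).comp measurable_fst
    · exact (measurable_pi_apply k).comp measurable_snd
  have hJ : Measurable fun p : coordSpace L × (κ → ℝ) => coordJoin α I p.1 p.2 :=
    continuous_coordJoin.measurable
  have hcomm : (fun p : coordSpace L × (κ → ℝ) => jI (coordJoin α I p.1 p.2)) =
      fun p => θ (Prod.map jL id p) := by
    funext p i
    obtain ⟨q, rfl⟩ := h.sumEquiv.surjective i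
    simp only [hθdef, Equiv.symm_apply_apply]
    rcases q with l | k
    · exact coordJoin_apply_left h p.1 p.2 l.2
    · exact coordJoin_apply_right h p.1 p.2 k
  have hpre : θ ⁻¹' Set.range jI = Set.range jL ×ˢ Set.univ := by
    ext p
    simp only [Set.mem_preimage, Set.mem_range, Set.mem_prod, Set.mem_univ, and_true]
    constructor
    · rintro ⟨x, hx⟩
      refine ⟨coordProj L (x : EllTwo), funext fun l => ?_⟩
      have := congrFun hx (h.sumEquiv (Sum.inl l))
      simp only [hθdef, Equiv.symm_apply_apply, Sum.elim_inl] at this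
      rw [← this]
      exact coordProj_apply_of_mem l.2 _
    · rintro ⟨z, hz⟩
      refine ⟨coordJoin α I z p.2, ?_⟩
      have := congrFun hcomm (z, p.2)
      simp only [Prod.map, hz, id] at this
      exact this
  have key : (gaussMeasure a I).map jI = ((gaussMeasure a L).prod
      (Measure.pi fun k => m (α k))).map (fun p => jI (coordJoin α I p.1 p.2)) := by
    rw [hcomm, gaussMeasure, eI.map_comap, ← infinitePi_prod_map_splitting h m,
      Measure.restrict_map hθ eI.measurableSet_range, hpre, ← Measure.prod_restrict,
      Measure.restrict_univ, ← eL.map_comap]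
    change _ = Measure.map (θ ∘ Prod.map jL id) _
    rw [← Measure.map_map hθ (eL.measurable.prodMap measurable_id)]
    rw [← Measure.map_prod_map _ _ eL.measurable measurable_id, Measure.map_id]
    rfl
  have hcm := congrArg (Measure.comap jI) key
  rw [eI.comap_map] at hcm
  rw [hcm]
  change Measure.comap jI (Measure.map (jI ∘ fun p : coordSpace L × (κ → ℝ) =>
    coordJoin α I p.1 p.2) _) = _
  rw [← Measure.map_map eI.measurable hJ, eI.comap_map]

theorem lintegral_gaussMeasure_splitting (h : IsSplitting L α I) {a : ℕ → ℝ} (ha : ∀ i, 0 < a i)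
    {g : coordSpace I → ℝ≥0∞} (hg : Measurable g) :
    ∫⁻ x, g x ∂(gaussMeasure a I) = ∫⁻ z, ∫⁻ u : κ → ℝ,
      (∏ k, gaussianPDF 0 (Real.toNNReal (a (α k) ^ 2)) (u k)) * g (coordJoin α I z u)
        ∂volume
        ∂(gaussMeasure a L) := by
  have hJ : Measurable fun p : coordSpace L × (κ → ℝ) => coordJoin α I p.1 p.2 :=
    continuous_coordJoin.measurable
  rw [gaussMeasure_eq_map_prod h a, lintegral_map hg hJ,
    lintegral_prod _ (show Measurable fun p : coordSpace L × (κ → ℝ) => g (coordJoin α I p.1 p.2)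
      from hg.comp hJ).aemeasurable]
  refine lintegral_congr fun z => ?_
  have hpdf : Measurable fun u : κ → ℝ =>
      ∏ k, gaussianPDF 0 (Real.toNNReal (a (α k) ^ 2)) (u k) :=
    Finset.measurable_prod _ fun k _ =>
      (measurable_gaussianPDF _ _).comp (measurable_pi_apply k)
  rw [pi_gaussianReal_eq_withDensity _ fun k => by
      have := ha (α k)
      simp only [ne_eq, Real.toNNReal_eq_zero, not_le]; positivity,
    lintegral_withDensity_eq_lintegral_mul _ hpdf (show Measurable fun u : κ → ℝ =>
      g (coordJoin α I (z, u).1 (z, u).2) from hg.comp (hJ.comp measurable_prodMk_left))]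
  rfl

end Join

/-! ### The equivalence of index sets -/

theorem IsSplitting.of_finset {I : Set ℕ} {c : Finset ℕ} {n : ℕ} (hc : (c : Set ℕ) ⊆ I)
    (hn : c.card = n) : IsSplitting (I \ c) (c.orderEmbOfFin hn) I where
  injective := (c.orderEmbOfFin hn).injective
  notMem k h := h.2 (c.orderEmbOfFin_mem hn k)
  eq_union := by rw [Finset.range_orderEmbOfFin, Set.sdiff_union_of_subset hc]

/-- The two families may overlap: only the indices in the difference of their ranges are
exchanged. -/
theorem IsSplitting.indexEquiv {κ : Type*} [Fintype κ] {L I K : Set ℕ} {c r : κ → ℕ}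
    (hI : IsSplitting L c I) (hK : IsSplitting L r K) : IndexEquiv I K := by
  classical
  have hmI : ∀ i, i ∈ I ↔ i ∈ L ∨ ∃ k, c k = i := fun i => by rw [hI.eq_union]; rfl
  have hmK : ∀ i, i ∈ K ↔ i ∈ L ∨ ∃ k, r k = i := fun i => by rw [hK.eq_union]; rfl
  set C := Finset.univ.image c with hC
  set R := Finset.univ.image r with hR
  have hCR : C.card = R.card := by
    rw [hC, hR, Finset.card_image_of_injective _ hI.injective,
      Finset.card_image_of_injective _ hK.injective]
  have hmC : ∀ i, i ∈ C ↔ ∃ k, c k = i := fun i => by simp [hC]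
  have hmR : ∀ i, i ∈ R ↔ ∃ k, r k = i := fun i => by simp [hR]
  have hLC : ∀ i, i ∈ L → i ∉ C := fun i hi h => by
    obtain ⟨k, rfl⟩ := (hmC i).1 h; exact hI.notMem k hi
  have hLR : ∀ i, i ∈ L → i ∉ R := fun i hi h => by
    obtain ⟨k, rfl⟩ := (hmR i).1 h; exact hK.notMem k hi
  simp only [← hmC] at hmI
  simp only [← hmR] at hmK
  refine ⟨C \ R, R \ C, ?_, ?_, Finset.card_sdiff_comm hCR, ?_⟩
  · intro i hi
    rw [Finset.mem_coe, Finset.mem_sdiff] at hi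
    exact (hmI i).2 (Or.inr hi.1)
  · intro i hi
    rw [Finset.mem_coe, Finset.mem_sdiff] at hi
    rw [Set.mem_compl_iff, hmI]
    rintro (h | h)
    · exact hLR i h hi.1
    · exact hi.2 h
  · ext i
    simp only [Set.mem_union, Set.mem_sdiff, Finset.mem_coe, Finset.mem_sdiff, hmI, hmK]
    have := hLC i
    have := hLR i
    tauto

/-- Finitely many exchanges can be carried out inside one finite set of indices: two sets equivalent
to `I` split, together with `I`, over one common subset `L`. -/
theorem exists_common_splitting {I K K' : Set ℕ} (h : IndexEquiv I K) (h' : IndexEquiv I K') :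
    ∃ (n : ℕ) (L : Set ℕ) (c r r' : Fin n → ℕ),
      IsSplitting L c I ∧ IsSplitting L r K ∧ IsSplitting L r' K' := by
  classical
  obtain ⟨A, B, hA, hB, hAB, rfl⟩ := h
  obtain ⟨A', B', hA', hB', hAB', rfl⟩ := h'
  set M : Finset ℕ := (A ∪ A' ∪ (B ∪ B')) with hM
  set C : Finset ℕ := {i ∈ M | i ∈ I} with hC
  have hCI : (C : Set ℕ) ⊆ I := fun i hi => (Finset.mem_filter.1 hi).2
  have key : ∀ A₀ B₀ : Finset ℕ, A₀ ⊆ M → B₀ ⊆ M → (A₀ : Set ℕ) ⊆ I → (B₀ : Set ℕ) ⊆ Iᶜ →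
      A₀.card = B₀.card → ∃ r : Fin C.card → ℕ,
        IsSplitting (I \ C) r ((I \ (A₀ : Set ℕ)) ∪ B₀) := by
    intro A₀ B₀ hAM hBM hAI hBI hc
    have hAC : A₀ ⊆ C := fun i hi => Finset.mem_filter.2 ⟨hAM hi, hAI hi⟩
    have hdis : Disjoint (C \ A₀) B₀ := Finset.disjoint_left.2 fun i hi hi' =>
      hBI hi' (hCI (Finset.mem_sdiff.1 hi).1)
    have hcard : ((C \ A₀) ∪ B₀).card = C.card := by
      rw [Finset.card_union_of_disjoint hdis, ← hc, Finset.card_sdiff_add_card_eq_card hAC]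
    have hsub : (((C \ A₀) ∪ B₀ : Finset ℕ) : Set ℕ) ⊆ (I \ (A₀ : Set ℕ)) ∪ B₀ := by
      intro i hi
      rcases Finset.mem_union.1 hi with hi | hi
      · rw [Finset.mem_sdiff] at hi
        exact Or.inl ⟨hCI hi.1, hi.2⟩
      · exact Or.inr hi
    have hs := IsSplitting.of_finset hsub hcard
    have hL : ((I \ (A₀ : Set ℕ)) ∪ B₀) \ (((C \ A₀) ∪ B₀ : Finset ℕ) : Set ℕ) = I \ C := by
      ext i
      simp only [Set.mem_union, Set.mem_sdiff, Finset.mem_coe, Finset.mem_sdiff, Finset.mem_union]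
      have h1 : i ∈ B₀ → i ∉ I := fun h => hBI h
      have h2 : i ∈ A₀ → i ∈ C := fun h => hAC h
      tauto
    exact ⟨_, hL ▸ hs⟩
  obtain ⟨r, hr⟩ := key A B (by intro i hi; simp [hM, hi]) (by intro i hi; simp [hM, hi]) hA hB hAB
  obtain ⟨r', hr'⟩ := key A' B' (by intro i hi; simp [hM, hi]) (by intro i hi; simp [hM, hi])
    hA' hB' hAB'
  exact ⟨C.card, I \ C, C.orderEmbOfFin rfl, r, r', IsSplitting.of_finset hCI rfl, hr, hr'⟩

theorem IndexEquiv.symm {I K : Set ℕ} (h : IndexEquiv I K) : IndexEquiv K I := by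
  obtain ⟨n, L, c, r, r', hc, hr, -⟩ := exists_common_splitting h h
  exact hr.indexEquiv hc

theorem IndexEquiv.trans {I J K : Set ℕ} (h : IndexEquiv I J) (h' : IndexEquiv J K) :
    IndexEquiv I K := by
  obtain ⟨n, L, c, r, r', hc, hr, hr'⟩ := exists_common_splitting h.symm h'
  exact hr.indexEquiv hr'

theorem indexClass_eq_of_indexEquiv {I J : Set ℕ} (h : IndexEquiv I J) :
    indexClass I = indexClass J :=
  Set.ext fun _ => ⟨h.symm.trans, h.trans⟩

/-! ### Plücker coordinates of a graph -/

/-- The absolute value of the minor of the family of vectors `t` with columns `c` and rows `r`. -/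
noncomputable def absMinor {κ : Type*} [Fintype κ] [DecidableEq κ] (t : ℕ → ℕ → ℝ)
    (r c : κ → ℕ) : ℝ :=
  |(Matrix.of fun k l => t (c l) (r k)).det|

theorem absMinor_congr {κ κ' : Type*} [Fintype κ] [DecidableEq κ] [Fintype κ'] [DecidableEq κ']
    (t : ℕ → ℕ → ℝ) {r c : κ → ℕ} {r' c' : κ' → ℕ} (hr : Function.Injective r)
    (hc : Function.Injective c) (hr' : Function.Injective r') (hc' : Function.Injective c')
    (hrr : Set.range r = Set.range r') (hcc : Set.range c = Set.range c') :
    absMinor t r c = absMinor t r' c' := by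
  have key : ∀ {u : κ → ℕ} {u' : κ' → ℕ}, Function.Injective u → Function.Injective u' →
      Set.range u = Set.range u' → ∃ e : κ ≃ κ', ∀ k, u' (e k) = u k := by
    intro u u' hu hu' h
    refine ⟨(Equiv.ofInjective u hu).trans ((Equiv.setCongr h).trans
      (Equiv.ofInjective u' hu').symm), fun k => ?_⟩
    exact congrArg Subtype.val ((Equiv.ofInjective u' hu').apply_symm_apply _)
  obtain ⟨er, her⟩ := key hr hr' hrr
  obtain ⟨ec, hec⟩ := key hc hc' hcc
  rw [absMinor, absMinor, ← Matrix.abs_det_submatrix_equiv_equiv er ec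
    (Matrix.of fun k l => t (c' l) (r' k))]
  congr 2
  ext k l
  simp [her, hec]

/-- `|det|` of the coordinates in `K` of the vectors `t j`, `j ∈ I`, relative to the identity on
`I ∩ K`: the Plücker coordinate at `K` of the span of `t j`, `j ∈ I`. It is the minor with columns
`I \ K` and rows `K \ I`, whose enumeration does not matter; it is set to `0` when these two sets
are not finite of the same size. -/
noncomputable def plucker (t : ℕ → ℕ → ℝ) (I K : Set ℕ) : ℝ :=
  open scoped Classical in
  if h : ∃ p : (n : ℕ) × (Fin n → ℕ) × (Fin n → ℕ),
      IsSplitting (I ∩ K) p.2.1 I ∧ IsSplitting (I ∩ K) p.2.2 K then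
    absMinor t h.choose.2.2 h.choose.2.1
  else 0

theorem IsSplitting.range_eq {κ : Type*} {L I : Set ℕ} {c : κ → ℕ} (h : IsSplitting L c I) :
    Set.range c = I \ L := by
  rw [h.eq_union, Set.union_sdiff_left]
  refine (sdiff_eq_left.2 ?_).symm
  exact Set.disjoint_left.2 (by rintro _ ⟨k, rfl⟩; exact h.notMem k)

theorem plucker_eq_absMinor_of_inter {κ : Type*} [Fintype κ] [DecidableEq κ] (t : ℕ → ℕ → ℝ)
    {I K : Set ℕ} {c r : κ → ℕ} (hc : IsSplitting (I ∩ K) c I) (hr : IsSplitting (I ∩ K) r K) :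
    plucker t I K = absMinor t r c := by
  have h : ∃ p : (n : ℕ) × (Fin n → ℕ) × (Fin n → ℕ),
      IsSplitting (I ∩ K) p.2.1 I ∧ IsSplitting (I ∩ K) p.2.2 K := by
    have e := (Fintype.equivFin κ).symm
    have key : ∀ {u : κ → ℕ} {J : Set ℕ}, IsSplitting (I ∩ K) u J →
        IsSplitting (I ∩ K) (u ∘ e) J := fun hu =>
      ⟨hu.injective.comp e.injective, fun k => hu.notMem _, by
        rw [e.surjective.range_comp]; exact hu.eq_union⟩
    exact ⟨⟨_, c ∘ e, r ∘ e⟩, key hc, key hr⟩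
  rw [plucker, dif_pos h]
  obtain ⟨h1, h2⟩ := h.choose_spec
  exact absMinor_congr t h2.injective h1.injective hr.injective hc.injective
    (by rw [h2.range_eq, hr.range_eq]) (by rw [h1.range_eq, hc.range_eq])

/-- The Plücker coordinate may be computed over any common subset `L` of `I` and `K` with finite
complements: the additional rows are rows of the identity matrix. -/
theorem plucker_eq_absMinor {κ : Type*} [Fintype κ] [DecidableEq κ] {t : ℕ → ℕ → ℝ}
    {L I K : Set ℕ} (ht : ∀ j ∈ I, ∀ k ∈ I, t j k = if k = j then 1 else 0) {c r : κ → ℕ}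
    (hc : IsSplitting L c I) (hr : IsSplitting L r K) :
    plucker t I K = absMinor t r c := by
  classical
  -- the positions of `c` and of `r` that lie in `I ∩ K`, and the remaining ones
  set B : Finset ℕ := {i ∈ Finset.univ.image c | i ∈ K} with hB
  set C : Finset ℕ := {i ∈ Finset.univ.image c | i ∉ K} with hC
  set R : Finset ℕ := {i ∈ Finset.univ.image r | i ∉ I} with hR
  have hmI : ∀ i, i ∈ I ↔ i ∈ L ∨ ∃ k, c k = i := fun i => by rw [hc.eq_union]; rfl
  have hmK : ∀ i, i ∈ K ↔ i ∈ L ∨ ∃ k, r k = i := fun i => by rw [hr.eq_union]; rfl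
  have hmB : ∀ i, i ∈ B ↔ (∃ k, c k = i) ∧ ∃ k, r k = i := fun i => by
    simp only [hB, Finset.mem_filter, Finset.mem_image, Finset.mem_univ, true_and, hmK]
    constructor
    · rintro ⟨⟨k, rfl⟩, h | h⟩
      · exact (hc.notMem k h).elim
      · exact ⟨⟨k, rfl⟩, h⟩
    · rintro ⟨h, h'⟩
      exact ⟨h, Or.inr h'⟩
  have hB' : B = {i ∈ Finset.univ.image r | i ∈ I} := by
    ext i
    rw [hmB]
    simp only [Finset.mem_filter, Finset.mem_image, Finset.mem_univ, true_and, hmI]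
    constructor
    · rintro ⟨h, h'⟩
      exact ⟨h', Or.inr h⟩
    · rintro ⟨⟨k, rfl⟩, h | h⟩
      · exact (hr.notMem k h).elim
      · exact ⟨h, ⟨k, rfl⟩⟩
  have hmC : ∀ i, i ∈ C ↔ (∃ k, c k = i) ∧ i ∉ K := fun i => by simp [hC]
  have hmR : ∀ i, i ∈ R ↔ (∃ k, r k = i) ∧ i ∉ I := fun i => by simp [hR]
  have hcard : R.card = C.card := by
    have h1 : B.card + C.card = Fintype.card κ := by
      rw [hB, hC, Finset.card_filter_add_card_filter_not,
        Finset.card_image_of_injective _ hc.injective, Finset.card_univ]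
    have h2 : B.card + R.card = Fintype.card κ := by
      rw [hB', hR, Finset.card_filter_add_card_filter_not,
        Finset.card_image_of_injective _ hr.injective, Finset.card_univ]
    omega
  set c₀ : Fin C.card → ℕ := ⇑(C.orderEmbOfFin rfl)
  set r₀ : Fin C.card → ℕ := ⇑(R.orderEmbOfFin hcard)
  have hc₀ : ∀ k, c₀ k ∈ C := C.orderEmbOfFin_mem rfl
  have hr₀ : ∀ k, r₀ k ∈ R := R.orderEmbOfFin_mem hcard
  have rc₀ : Set.range c₀ = C := Finset.range_orderEmbOfFin _ _
  have rr₀ : Set.range r₀ = R := Finset.range_orderEmbOfFin _ _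
  have ic₀ : Function.Injective c₀ := (C.orderEmbOfFin rfl).injective
  have ir₀ : Function.Injective r₀ := (R.orderEmbOfFin hcard).injective
  have sc₀ : IsSplitting (I ∩ K) c₀ I := by
    refine ⟨ic₀, fun k hk => ((hmC _).1 (hc₀ k)).2 hk.2, ?_⟩
    ext i
    rw [rc₀, Set.mem_union, Finset.mem_coe, hmC, Set.mem_inter_iff, hmI, hmK]
    tauto
  have sr₀ : IsSplitting (I ∩ K) r₀ K := by
    refine ⟨ir₀, fun k hk => ((hmR _).1 (hr₀ k)).2 hk.1, ?_⟩
    ext i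
    rw [rr₀, Set.mem_union, Finset.mem_coe, hmR, Set.mem_inter_iff, hmI, hmK]
    tauto
  rw [plucker_eq_absMinor_of_inter t sc₀ sr₀]
  have hBC : Function.Injective (Sum.elim (fun b : B => (b : ℕ)) c₀) := by
    refine Function.Injective.sumElim Subtype.val_injective ic₀ fun b k h => ?_
    exact ((hmC _).1 (hc₀ k)).2 (h ▸ (Finset.mem_filter.1 b.2).2)
  have hBR : Function.Injective (Sum.elim (fun b : B => (b : ℕ)) r₀) := by
    refine Function.Injective.sumElim Subtype.val_injective ir₀ fun b k h => ?_
    have hb := (Finset.ext_iff.1 hB' b).1 b.2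
    exact ((hmR _).1 (hr₀ k)).2 (h ▸ (Finset.mem_filter.1 hb).2)
  have hrange : ∀ u : Fin C.card → ℕ, ∀ A : Finset ℕ, Set.range u = A →
      Set.range (Sum.elim (fun b : B => (b : ℕ)) u) = (B : Set ℕ) ∪ A := fun u A h => by
    rw [Set.Sum.elim_range, h, Subtype.range_coe_subtype]; rfl
  rw [← absMinor_congr t hBR hBC hr.injective hc.injective]
  · have hmat : (Matrix.of fun k l => t (Sum.elim (fun b : B => (b : ℕ)) c₀ l)
        (Sum.elim (fun b : B => (b : ℕ)) r₀ k)) =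
        Matrix.fromBlocks 1 0 (Matrix.of fun k (b : B) => t b (r₀ k))
          (Matrix.of fun k l => t (c₀ l) (r₀ k)) := by
      have hBI : ∀ b : B, (b : ℕ) ∈ I := fun b => (hmI _).2 (Or.inr ((hmB _).1 b.2).1)
      ext (b | k) (b' | l)
      · simp only [Matrix.of_apply, Sum.elim_inl, Matrix.fromBlocks_apply₁₁]
        rw [ht _ (hBI b') _ (hBI b), Matrix.one_apply]
        simp only [Subtype.ext_iff]
      · simp only [Matrix.of_apply, Sum.elim_inl, Sum.elim_inr, Matrix.fromBlocks_apply₁₂]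
        have hl := hc₀ l
        rw [ht _ ((hmI _).2 (Or.inr ((hmC _).1 hl).1)) _ (hBI b), if_neg, Matrix.zero_apply]
        intro h
        exact ((hmC _).1 hl).2 (h ▸ (Finset.mem_filter.1 b.2).2)
      · rfl
      · rfl
    rw [absMinor, absMinor, hmat, Matrix.det_fromBlocks_zero₁₂, Matrix.det_one, one_mul]
  · rw [hrange r₀ R rr₀]
    ext i
    simp only [Set.mem_union, Finset.mem_coe, hB', hR, Finset.mem_filter, Finset.mem_image,
      Finset.mem_univ, true_and, Set.mem_range]
    tauto
  · rw [hrange c₀ C rc₀]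
    ext i
    simp only [Set.mem_union, Finset.mem_coe, hB, hC, Finset.mem_filter, Finset.mem_image,
      Finset.mem_univ, true_and, Set.mem_range]
    tauto

/-- If the vectors `t (c₁ l)` are combinations of the vectors `t' (c₂ b)`, with their own
coordinates at `c₂ b` as coefficients, then the minors of both families differ by the determinant
of the change of basis. -/
theorem absMinor_mul {κ : Type*} [Fintype κ] [DecidableEq κ] {t t' : ℕ → ℕ → ℝ} {c₁ c₂ r : κ → ℕ}
    (h : ∀ l k, t (c₁ l) (r k) = ∑ b, t (c₁ l) (c₂ b) * t' (c₂ b) (r k)) :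
    absMinor t r c₁ = absMinor t' r c₂ * absMinor t c₂ c₁ := by
  rw [absMinor, absMinor, absMinor, ← abs_mul, ← Matrix.det_mul]
  congr 2
  ext k l
  simp only [Matrix.of_apply, Matrix.mul_apply, h l k]
  exact Finset.sum_congr rfl fun _ _ => mul_comm _ _

/-! ### The area factor as the norm of the Plücker vector -/

/-- The tangent vector `e_j + D e_j`, `j ∈ I`, of the graph of a map with derivative `D`. For
`j ∉ I` it is `0`. -/
noncomputable def graphFrame {I : Set ℕ} (D : coordSpace I →L[ℝ] coordSpace Iᶜ) (j : ℕ) : EllTwo :=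
  (coordProj I (stdVec j) : EllTwo) + (D (coordProj I (stdVec j)) : EllTwo)

theorem graph_apply_of_mem {I : Set ℕ} {k : ℕ} (hk : k ∈ I) (y : coordSpace I)
    (w : coordSpace Iᶜ) : ((y : EllTwo) + (w : EllTwo) : EllTwo) k = (y : EllTwo) k := by
  rw [lp.coeFn_add, Pi.add_apply, coordSpace_apply_of_notMem (fun h : k ∈ Iᶜ => h hk) w, add_zero]

theorem graph_apply_of_notMem {I : Set ℕ} {k : ℕ} (hk : k ∉ I) (y : coordSpace I)
    (w : coordSpace Iᶜ) : ((y : EllTwo) + (w : EllTwo) : EllTwo) k = (w : EllTwo) k := by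
  rw [lp.coeFn_add, Pi.add_apply, coordSpace_apply_of_notMem hk y, zero_add]

theorem graphFrame_apply_of_mem {I : Set ℕ} (D : coordSpace I →L[ℝ] coordSpace Iᶜ) {k : ℕ}
    (hk : k ∈ I) (j : ℕ) : graphFrame D j k = if k = j then 1 else 0 := by
  rw [graphFrame, graph_apply_of_mem hk, coordProj_apply_of_mem hk, stdVec_apply]

theorem HasFDerivAt.chart_coord {I : Set ℕ} {f : coordSpace I → coordSpace Iᶜ}
    {x : coordSpace I} {D : coordSpace I →L[ℝ] coordSpace Iᶜ} (hf : HasFDerivAt f D x) (i : ℕ) :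
    HasFDerivAt (fun y => (f y : EllTwo) i)
      (((lp.evalCLM ℝ (fun _ : ℕ => ℝ) 2 i).comp (coordSpace Iᶜ).subtypeL).comp D) x :=
  ((lp.evalCLM ℝ (fun _ : ℕ => ℝ) 2 i).comp (coordSpace Iᶜ).subtypeL).hasFDerivAt.comp x hf

theorem chartPartial_eq_graphFrame {I : Set ℕ} {f : coordSpace I → coordSpace Iᶜ}
    {x : coordSpace I} {D : coordSpace I →L[ℝ] coordSpace Iᶜ} (hf : HasFDerivAt f D x)
    (i : (Iᶜ : Set ℕ)) (j : I) : chartPartial f x i j = graphFrame D j i := by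
  rw [chartPartial, ((hf.chart_coord i).hasLineDerivAt _).lineDeriv, graphFrame,
    graph_apply_of_notMem i.2, ← coordVec_eq_coordProj]
  rfl

/-- The index set that arises from `I` by exchanging `p.1` for `p.2`. -/
def exchange {I : Set ℕ} (p : MinorIndex I) : Set ℕ :=
  {i | (i ∈ I ∧ ∀ h : i ∈ I, (⟨i, h⟩ : I) ∉ p.1.1) ∨ ∃ h : i ∈ Iᶜ, (⟨i, h⟩ : (Iᶜ : Set ℕ)) ∈ p.1.2}

theorem mem_exchange_of_mem {I : Set ℕ} (p : MinorIndex I) {i : ℕ} (hi : i ∈ I) :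
    i ∈ exchange p ↔ (⟨i, hi⟩ : I) ∉ p.1.1 := by
  constructor
  · rintro (h | ⟨h, -⟩)
    · exact h.2 hi
    · exact (h hi).elim
  · exact fun h => Or.inl ⟨hi, fun _ => h⟩

theorem mem_exchange_of_notMem {I : Set ℕ} (p : MinorIndex I) {i : ℕ} (hi : i ∈ Iᶜ) :
    i ∈ exchange p ↔ (⟨i, hi⟩ : (Iᶜ : Set ℕ)) ∈ p.1.2 := by
  constructor
  · rintro (h | ⟨h, h'⟩)
    · exact (hi h.1).elim
    · exact h'
  · exact fun h => Or.inr ⟨hi, h⟩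

theorem exchange_injective {I : Set ℕ} : Function.Injective (exchange (I := I)) := by
  intro p q h
  refine Subtype.ext (Prod.ext ?_ ?_)
  · ext ⟨i, hi⟩
    rw [← not_iff_not, ← mem_exchange_of_mem, ← mem_exchange_of_mem, h]
  · ext ⟨i, hi⟩
    rw [← mem_exchange_of_notMem, ← mem_exchange_of_notMem, h]

theorem isSplitting_exchange_left {I : Set ℕ} (p : MinorIndex I) :
    IsSplitting (I ∩ exchange p) (fun k => (p.1.1.orderEmbOfFin rfl k : ℕ)) I := by
  refine ⟨Subtype.val_injective.comp (p.1.1.orderEmbOfFin rfl).injective, fun k hk => ?_, ?_⟩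
  · exact (mem_exchange_of_mem p (Subtype.coe_prop _)).1 hk.2 (p.1.1.orderEmbOfFin_mem rfl k)
  · have hr : Set.range (fun k => (p.1.1.orderEmbOfFin rfl k : ℕ)) =
        Subtype.val '' (p.1.1 : Set I) := by
      rw [← Finset.range_orderEmbOfFin p.1.1 rfl, ← Set.range_comp]; rfl
    rw [hr]
    ext i
    constructor
    · intro hi
      by_cases h : (⟨i, hi⟩ : I) ∈ p.1.1
      · exact Or.inr ⟨_, h, rfl⟩
      · exact Or.inl ⟨hi, (mem_exchange_of_mem p hi).2 h⟩
    · rintro (hi | ⟨x, -, rfl⟩)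
      · exact hi.1
      · exact x.2

theorem isSplitting_exchange_right {I : Set ℕ} (p : MinorIndex I) :
    IsSplitting (I ∩ exchange p) (fun k => (p.1.2.orderEmbOfFin p.2.1.symm k : ℕ))
      (exchange p) := by
  refine ⟨Subtype.val_injective.comp (p.1.2.orderEmbOfFin p.2.1.symm).injective,
    fun k hk => (Subtype.coe_prop (p.1.2.orderEmbOfFin p.2.1.symm k)) hk.1, ?_⟩
  have hr : Set.range (fun k => (p.1.2.orderEmbOfFin p.2.1.symm k : ℕ)) =
      Subtype.val '' (p.1.2 : Set (Iᶜ : Set ℕ)) := by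
    rw [← Finset.range_orderEmbOfFin p.1.2 p.2.1.symm, ← Set.range_comp]; rfl
  rw [hr]
  ext i
  constructor
  · intro hi
    by_cases h : i ∈ I
    · exact Or.inl ⟨h, hi⟩
    · exact Or.inr ⟨⟨i, h⟩, (mem_exchange_of_notMem p h).1 hi, rfl⟩
  · rintro (hi | ⟨x, hx, rfl⟩)
    · exact hi.2
    · exact (mem_exchange_of_notMem p x.2).2 hx

theorem exchange_ne {I : Set ℕ} (p : MinorIndex I) : exchange p ≠ I := by
  intro h
  obtain ⟨x, hx⟩ : p.1.1.Nonempty := Finset.card_pos.1 p.2.2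
  exact (mem_exchange_of_mem p x.2).1 (h.symm ▸ x.2) hx

theorem IndexEquiv.exists_exchange {I K : Set ℕ} (h : IndexEquiv I K) (hne : K ≠ I) :
    ∃ p : MinorIndex I, exchange p = K := by
  classical
  obtain ⟨A, B, hA, hB, hAB, rfl⟩ := h
  refine ⟨⟨⟨A.subtype (· ∈ I), B.subtype (· ∈ Iᶜ)⟩, ?_, ?_⟩, ?_⟩
  · rw [Finset.card_subtype, Finset.card_subtype, Finset.filter_true_of_mem hA,
      Finset.filter_true_of_mem hB, hAB]
  · rw [Finset.card_subtype, Finset.filter_true_of_mem hA, Nat.one_le_iff_ne_zero]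
    intro h0
    refine hne ?_
    rw [Finset.card_eq_zero.1 h0, Finset.card_eq_zero.1 (hAB ▸ h0 : B.card = 0)]
    simp
  · ext i
    by_cases hi : i ∈ I
    · rw [mem_exchange_of_mem _ hi]
      have : i ∉ B := fun h => hB h hi
      simp [hi, this]
    · rw [mem_exchange_of_notMem _ hi]
      simp [hi]

theorem plucker_self {I : Set ℕ} (t : ℕ → ℕ → ℝ) : plucker t I I = 1 := by
  have h : IsSplitting (I ∩ I) (Fin.elim0 : Fin 0 → ℕ) I :=
    ⟨fun k => k.elim0, fun k => k.elim0, by simp⟩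
  rw [plucker_eq_absMinor_of_inter t h h, absMinor, Matrix.det_isEmpty, abs_one]

theorem areaFactor_eq_tsum_plucker {I : Set ℕ} {f : coordSpace I → coordSpace Iᶜ}
    {x : coordSpace I} {D : coordSpace I →L[ℝ] coordSpace Iᶜ} (hf : HasFDerivAt f D x) :
    areaFactor f x = (∑' K : indexClass I,
      ENNReal.ofReal (plucker (fun j k => graphFrame D j k) I K ^ 2)) ^ (1 / 2 : ℝ) := by
  classical
  have hself : I ∈ indexClass I := ⟨∅, ∅, by simp, by simp, rfl, by simp⟩
  rw [areaFactor, ENNReal.tsum_eq_add_tsum_ite (⟨I, hself⟩ : indexClass I), plucker_self]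
  congr 2
  · simp
  · set Φ : MinorIndex I → indexClass I := fun p =>
      ⟨exchange p, (isSplitting_exchange_left p).indexEquiv (isSplitting_exchange_right p)⟩ with hΦ
    have hinj : Function.Injective Φ := fun p q h =>
      exchange_injective (congrArg Subtype.val h)
    rw [← hinj.tsum_eq]
    · refine tsum_congr fun p => ?_
      rw [if_neg (fun h => exchange_ne p (congrArg Subtype.val h))]
      congr 2
      rw [hΦ, plucker_eq_absMinor_of_inter _ (isSplitting_exchange_left p)
        (isSplitting_exchange_right p), absMinor, chartMinor]
      congr 3
      ext k l
      exact chartPartial_eq_graphFrame hf _ _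
    · intro K hK
      have hne : (K : Set ℕ) ≠ I := by
        intro h
        refine hK ?_
        have hK' : K = ⟨I, hself⟩ := Subtype.ext h
        exact if_pos hK'
      obtain ⟨p, hp⟩ := IndexEquiv.exists_exchange K.2 hne
      exact ⟨p, Subtype.ext hp⟩

/-- The area factors of two graph representations of the same tangent space differ by the Jacobian
of the change of coordinates: both are norms of a Plücker vector of that space, normalized to be
`1` at `I₁` and at `I₂` respectively. -/
theorem areaFactor_eq_mul {κ : Type*} [Fintype κ] [DecidableEq κ] {L I₁ I₂ : Set ℕ}
    {c₁ c₂ : κ → ℕ} (h₁ : IsSplitting L c₁ I₁) (h₂ : IsSplitting L c₂ I₂)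
    {f₁ : coordSpace I₁ → coordSpace I₁ᶜ} {f₂ : coordSpace I₂ → coordSpace I₂ᶜ}
    {x₁ : coordSpace I₁} {x₂ : coordSpace I₂}
    {D₁ : coordSpace I₁ →L[ℝ] coordSpace I₁ᶜ} {D₂ : coordSpace I₂ →L[ℝ] coordSpace I₂ᶜ}
    (hf₁ : HasFDerivAt f₁ D₁ x₁) (hf₂ : HasFDerivAt f₂ D₂ x₂)
    (htan : ∀ j, graphFrame D₁ j = (coordProj I₂ (graphFrame D₁ j) : EllTwo) +
      (D₂ (coordProj I₂ (graphFrame D₁ j)) : EllTwo)) :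
    areaFactor f₁ x₁ = ENNReal.ofReal (absMinor (fun j k => graphFrame D₁ j k) c₂ c₁) *
      areaFactor f₂ x₂ := by
  have hI : IndexEquiv I₁ I₂ := h₁.indexEquiv h₂
  set t₁ : ℕ → ℕ → ℝ := fun j k => graphFrame D₁ j k with ht₁
  set t₂ : ℕ → ℕ → ℝ := fun j k => graphFrame D₂ j k with ht₂
  have hδ₁ : ∀ j ∈ I₁, ∀ k ∈ I₁, t₁ j k = if k = j then 1 else 0 := fun j _ k hk =>
    graphFrame_apply_of_mem D₁ hk j
  have hδ₂ : ∀ j ∈ I₂, ∀ k ∈ I₂, t₂ j k = if k = j then 1 else 0 := fun j _ k hk =>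
    graphFrame_apply_of_mem D₂ hk j
  -- the projection of `t₁ (c l)` to `P_{I₂}` has no coordinates in the common part `M`
  have hexp : ∀ {n : ℕ} {M : Set ℕ} {c r : Fin n → ℕ}, IsSplitting M c I₁ → IsSplitting M r I₂ →
      ∀ l k, t₁ (c l) k = ∑ b, t₁ (c l) (r b) * t₂ (r b) k := by
    intro n M c r hc hr l k
    have hproj : coordProj I₂ (graphFrame D₁ (c l)) =
        ∑ b, t₁ (c l) (r b) • coordProj I₂ (stdVec (r b)) := by
      have hcoord : ∀ i, ((∑ b, t₁ (c l) (r b) • coordProj I₂ (stdVec (r b)) :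
          coordSpace I₂) : EllTwo) i =
          ∑ b, t₁ (c l) (r b) * (coordProj I₂ (stdVec (r b)) : EllTwo) i := fun i => by
        rw [Submodule.coe_sum, sum_coord]; rfl
      refine coordSpace_ext_of_splitting hr (fun i hi => ?_) fun k => ?_
      · have hne : i ≠ c l := fun e => hc.notMem l (e ▸ hi)
        rw [hcoord, coordProj_apply_of_mem (hr.left_mem hi),
          graphFrame_apply_of_mem D₁ (hc.left_mem hi), if_neg hne]
        refine (Finset.sum_eq_zero fun b _ => ?_).symm
        have hne' : i ≠ r b := fun e => hr.notMem b (e ▸ hi)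
        rw [coordProj_apply_of_mem (hr.left_mem hi), stdVec_apply, if_neg hne', mul_zero]
      · rw [hcoord, coordProj_apply_of_mem (hr.right_mem k), Finset.sum_eq_single k]
        · rw [coordProj_apply_of_mem (hr.right_mem k), stdVec_apply, if_pos rfl, mul_one]
        · intro b _ hb
          rw [coordProj_apply_of_mem (hr.right_mem k), stdVec_apply,
            if_neg fun e => hb (hr.injective e).symm, mul_zero]
        · exact fun h => (h (Finset.mem_univ k)).elim
    have hsum : graphFrame D₁ (c l) = ∑ b, t₁ (c l) (r b) • graphFrame D₂ (r b) := by
      rw [htan, hproj, map_sum, Submodule.coe_sum, Submodule.coe_sum, ← Finset.sum_add_distrib]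
      refine Finset.sum_congr rfl fun b _ => ?_
      rw [map_smul, graphFrame, smul_add]
      rfl
    have := congrArg (fun v : EllTwo => v k) hsum
    simp only [sum_coord] at this
    exact this
  have hpl : ∀ K : Set ℕ, K ∈ indexClass I₁ →
      plucker t₁ I₁ K = absMinor t₁ c₂ c₁ * plucker t₂ I₂ K := by
    intro K hK
    obtain ⟨n, M, c, r, r', hc, hr, hr'⟩ := exists_common_splitting hI hK
    rw [plucker_eq_absMinor hδ₁ hc hr', plucker_eq_absMinor hδ₂ hr hr',
      ← plucker_eq_absMinor hδ₁ h₁ h₂, plucker_eq_absMinor hδ₁ hc hr, mul_comm]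
    exact absMinor_mul fun l k => hexp hc hr l _
  rw [areaFactor_eq_tsum_plucker hf₁, areaFactor_eq_tsum_plucker hf₂,
    ← indexClass_eq_of_indexEquiv hI]
  have hnn : 0 ≤ absMinor t₁ c₂ c₁ := abs_nonneg _
  have hsq : ENNReal.ofReal (absMinor t₁ c₂ c₁) =
      (ENNReal.ofReal (absMinor t₁ c₂ c₁ ^ 2)) ^ (1 / 2 : ℝ) := by
    rw [ENNReal.ofReal_rpow_of_nonneg (by positivity) (by norm_num), ← Real.sqrt_eq_rpow,
      Real.sqrt_sq hnn]
  rw [hsq, ← ENNReal.mul_rpow_of_nonneg _ _ (by norm_num), ← ENNReal.tsum_mul_left]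
  congr 1
  refine tsum_congr fun K => ?_
  rw [hpl K K.2, mul_pow, ENNReal.ofReal_mul (by positivity)]

/-! ### Measurability of the local density -/

theorem ContinuousOn.measurable_indicator_of_isOpen {X : Type*} [TopologicalSpace X]
    [MeasurableSpace X] [BorelSpace X] {V : Set X} (hV : IsOpen V) {g : X → ℝ}
    (hg : ContinuousOn g V) : Measurable (V.indicator g) := by
  classical
  rw [← Set.piecewise_eq_indicator]
  exact hg.measurable_piecewise continuous_const.continuousOn hV.measurableSet

section Measurability

variable {I : Set ℕ} {f : coordSpace I → coordSpace Iᶜ} {V : Set (coordSpace I)}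

theorem DifferentiableOn.continuousOn_coord (hf : DifferentiableOn ℝ f V) (i : ℕ) :
    ContinuousOn (fun y => (f y : EllTwo) i) V :=
  ((continuous_coord i).comp continuous_subtype_val).comp_continuousOn hf.continuousOn

/-- Near a point of `V` the difference quotients see only values of `f` on `V`, so the partial
derivative is on `V` a limit of measurable functions although `f` is arbitrary off `V`. -/
theorem measurable_indicator_chartPartial (hV : IsOpen V) (hf : DifferentiableOn ℝ f V)
    (i : (Iᶜ : Set ℕ)) (j : I) : Measurable (V.indicator fun x => chartPartial f x i j) := by
  set G := V.indicator fun y => (f y : EllTwo) (i : ℕ) with hG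
  have hGm : Measurable G :=
    (hf.continuousOn_coord (i : ℕ)).measurable_indicator_of_isOpen hV
  refine measurable_of_tendsto_metrizable (f := fun (n : ℕ) => V.indicator fun y =>
    ((n : ℝ) + 1) * (G (y + ((n : ℝ) + 1)⁻¹ • coordVec I j) - G y)) (fun n => ?_) ?_
  · refine Measurable.indicator ?_ hV.measurableSet
    exact ((hGm.comp (measurable_id.add_const _)).sub hGm).const_mul _
  · rw [tendsto_pi_nhds]
    intro y
    by_cases hy : y ∈ V
    · simp only [Set.indicator_of_mem hy]
      have hd : HasFDerivAt f (fderiv ℝ f y) y :=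
        (hf.differentiableAt (hV.mem_nhds hy)).hasFDerivAt
      have h1 := hd.chart_coord (i : ℕ)
      have hEq : G =ᶠ[nhds y] fun y => (f y : EllTwo) (i : ℕ) := by
        filter_upwards [hV.mem_nhds hy] with w hw
        rw [hG, Set.indicator_of_mem hw]
      have h2 := (h1.congr_of_eventuallyEq hEq).hasLineDerivAt (coordVec I j)
      have h3 : Filter.Tendsto (fun n : ℕ => ((n : ℝ) + 1)⁻¹) Filter.atTop
          (nhdsWithin 0 {0}ᶜ) := by
        refine tendsto_nhdsWithin_iff.2 ⟨?_, Filter.Eventually.of_forall fun n => ?_⟩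
        · simpa [one_div] using tendsto_one_div_add_atTop_nhds_zero_nat (𝕜 := ℝ)
        · have : (0 : ℝ) < (n : ℝ) + 1 := by positivity
          simp [this.ne']
      have h4 := h2.tendsto_slope_zero.comp h3
      have h5 : chartPartial f y i j = (((lp.evalCLM ℝ (fun _ : ℕ => ℝ) 2 (i : ℕ)).comp
          (coordSpace Iᶜ).subtypeL).comp (fderiv ℝ f y)) (coordVec I j) :=
        (h1.hasLineDerivAt _).lineDeriv
      rw [h5]
      simpa [Function.comp_def] using h4
    · simp only [Set.indicator_of_notMem hy]
      exact tendsto_const_nhds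

theorem measurable_indicator_areaFactor (hV : IsOpen V) (hf : DifferentiableOn ℝ f V) :
    Measurable (V.indicator (areaFactor f)) := by
  have hrw : V.indicator (areaFactor f) = V.indicator fun x =>
      (1 + ∑' p : MinorIndex I, ENNReal.ofReal (|(Matrix.of fun k l : Fin p.1.1.card =>
        V.indicator (fun x => chartPartial f x (p.1.2.orderEmbOfFin p.2.1.symm k)
          (p.1.1.orderEmbOfFin rfl l)) x).det| ^ 2)) ^ (1 / 2 : ℝ) := by
    refine Set.indicator_congr fun x hx => ?_
    simp only [Set.indicator_of_mem hx]
    rfl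
  rw [hrw]
  refine Measurable.indicator ?_ hV.measurableSet
  refine Measurable.pow_const (Measurable.const_add ?_ 1) _
  refine Measurable.tsum (L := .unconditional (MinorIndex I)) fun p => ?_
  refine ENNReal.measurable_ofReal.comp (Measurable.pow_const ?_ 2)
  refine Measurable.abs ?_
  simp only [Matrix.det_apply, Matrix.of_apply]
  refine Finset.measurable_fun_sum _ fun σ _ => Measurable.const_smul ?_ _
  exact Finset.measurable_fun_prod _ fun k _ => measurable_indicator_chartPartial hV hf _ _

theorem measurable_indicator_density {a : ℕ → ℝ} (hV : IsOpen V)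
    (hf : DifferentiableOn ℝ f V) :
    Measurable (V.indicator fun y => ENNReal.ofReal (density a Iᶜ (f y))) := by
  have hrw : (V.indicator fun y => ENNReal.ofReal (density a Iᶜ (f y))) = V.indicator fun y =>
      ENNReal.ofReal (Real.exp (∑' i : (Iᶜ : Set ℕ),
        V.indicator (fun y => logDensity a (f y) i) y)) := by
    refine Set.indicator_congr fun x hx => ?_
    simp only [Set.indicator_of_mem hx]
    rfl
  rw [hrw]
  refine Measurable.indicator (ENNReal.measurable_ofReal.comp (Real.measurable_exp.comp
    (Measurable.tsum (L := .unconditional _) fun i =>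
      ContinuousOn.measurable_indicator_of_isOpen hV ?_)))
    hV.measurableSet
  exact continuousOn_const.sub (((hf.continuousOn_coord i).pow 2).div_const _)

end Measurability

/-! ### Geometry of coordinate pairings -/

theorem IsCoordinatePairing.injOn {I J : Set ℕ} {S U : Set EllTwo}
    (hp : IsCoordinatePairing I S U J) : Set.InjOn (coordProj J) (S ∩ U) :=
  Set.injOn_iff_injective.2 hp.homeo.injective

theorem IsCoordinatePairing.isOpen_image {I J : Set ℕ} {S U : Set EllTwo}
    (hp : IsCoordinatePairing I S U J) {W : Set EllTwo} (hW : IsOpen W) :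
    IsOpen (coordProj J '' (S ∩ U ∩ W)) := by
  have h := hp.homeo.isOpenMap _ (hW.preimage continuous_subtype_val)
  convert h using 1
  ext y
  constructor
  · rintro ⟨x, ⟨hx, hxW⟩, rfl⟩
    exact ⟨⟨x, hx⟩, hxW, rfl⟩
  · rintro ⟨⟨x, hx⟩, hxW, rfl⟩
    exact ⟨x, ⟨hx, hxW⟩, rfl⟩

theorem IsCoordinatePairing.isOpen_chartDomain {I J : Set ℕ} {S U : Set EllTwo}
    (hp : IsCoordinatePairing I S U J) : IsOpen (chartDomain S U J) := by
  have := hp.isOpen_image isOpen_univ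
  rwa [Set.inter_univ] at this

theorem IsCoordinatePairing.measurableSet_image {I J : Set ℕ} {S U : Set EllTwo}
    (hp : IsCoordinatePairing I S U J) {E : Set S} (hE : MeasurableSet E)
    (hEU : Subtype.val '' E ⊆ U) : MeasurableSet (coordProj J '' (Subtype.val '' E)) := by
  have h := hp.homeo.measurableEmbedding.measurableSet_image.2
    (measurable_inclusion (Set.inter_subset_left : S ∩ U ⊆ S) hE)
  convert h using 1
  ext y
  constructor
  · rintro ⟨_, ⟨x, hx, rfl⟩, rfl⟩
    exact ⟨⟨x, x.2, hEU ⟨x, hx, rfl⟩⟩, hx, rfl⟩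
  · rintro ⟨x, hx, rfl⟩
    exact ⟨_, ⟨_, hx, rfl⟩, rfl⟩

namespace IsLocallyFinitePairing

variable {a : ℕ → ℝ} {I J : Set ℕ} {S U : Set EllTwo} {f : coordSpace J → coordSpace Jᶜ}

theorem graph_eq (hp : IsLocallyFinitePairing a I S U J f) {x : EllTwo} (hx : x ∈ S ∩ U) :
    (coordProj J x : EllTwo) + (f (coordProj J x) : EllTwo) = x := by
  have hx' := hx
  rw [hp.graph] at hx'
  obtain ⟨y, -, rfl⟩ := hx'
  have : coordProj J ((y : EllTwo) + (f y : EllTwo)) = y :=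
    coordSpace_ext fun i hi => by rw [coordProj_apply_of_mem hi, graph_apply_of_mem hi]
  rw [this]

theorem measurable_indicator_weight (hp : IsLocallyFinitePairing a I S U J f)
    {Q : Set (coordSpace J)} (hQ : MeasurableSet Q) (hQV : Q ⊆ chartDomain S U J) :
    Measurable (Q.indicator fun y => areaFactor f y * ENNReal.ofReal (density a Jᶜ (f y))) := by
  have hV := hp.pairing.isOpen_chartDomain
  have h := (measurable_indicator_areaFactor hV hp.differentiable).mul
    (measurable_indicator_density (a := a) hV hp.differentiable)
  convert h.indicator hQ using 1
  refine Set.indicator_congr fun y hy => ?_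
  rw [Pi.mul_apply, Set.indicator_of_mem (hQV hy), Set.indicator_of_mem (hQV hy)]

theorem hasFDerivAt (hp : IsLocallyFinitePairing a I S U J f) {x : EllTwo} (hx : x ∈ S ∩ U) :
    HasFDerivAt f (fderiv ℝ f (coordProj J x)) (coordProj J x) :=
  (hp.differentiable.differentiableAt (hp.pairing.isOpen_chartDomain.mem_nhds
    ⟨x, hx, rfl⟩)).hasFDerivAt

/-- Tangent vectors in one chart lie on the graph of the derivative in the other chart. -/
theorem graphFrame_eq (hp : IsLocallyFinitePairing a I S U J f) {U' : Set EllTwo} {J' : Set ℕ}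
    {f' : coordSpace J' → coordSpace J'ᶜ} (hp' : IsLocallyFinitePairing a I S U' J' f')
    {x : EllTwo} (hx : x ∈ S ∩ U) (hx' : x ∈ S ∩ U') (j : ℕ) :
    graphFrame (fderiv ℝ f (coordProj J x)) j =
      (coordProj J' (graphFrame (fderiv ℝ f (coordProj J x)) j) : EllTwo) +
      (fderiv ℝ f' (coordProj J' x)
        (coordProj J' (graphFrame (fderiv ℝ f (coordProj J x)) j)) : EllTwo) := by
  set D := fderiv ℝ f (coordProj J x) with hD
  set D' := fderiv ℝ f' (coordProj J' x) with hD'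
  set G : coordSpace J → EllTwo := fun y => (y : EllTwo) + (f y : EllTwo) with hG
  set G' : coordSpace J' → EllTwo := fun y => (y : EllTwo) + (f' y : EllTwo) with hG'
  have dG : HasFDerivAt G ((coordSpace J).subtypeL + (coordSpace Jᶜ).subtypeL.comp D)
      (coordProj J x) :=
    (coordSpace J).subtypeL.hasFDerivAt.add
      ((coordSpace Jᶜ).subtypeL.hasFDerivAt.comp _ (hp.hasFDerivAt hx))
  have dG' : HasFDerivAt G' ((coordSpace J').subtypeL + (coordSpace J'ᶜ).subtypeL.comp D')
      (coordProj J' x) :=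
    (coordSpace J').subtypeL.hasFDerivAt.add
      ((coordSpace J'ᶜ).subtypeL.hasFDerivAt.comp _ (hp'.hasFDerivAt hx'))
  have hGx : G (coordProj J x) = x := hp.graph_eq hx
  have dP : HasFDerivAt (fun y => coordProj J' (G y)) ((coordProj J').comp
      ((coordSpace J).subtypeL + (coordSpace Jᶜ).subtypeL.comp D)) (coordProj J x) :=
    (coordProj J').hasFDerivAt.comp _ dG
  have dC := HasFDerivAt.comp (g := G') (coordProj J x)
    (by rw [hGx]; exact dG') dP
  have hEq : G =ᶠ[nhds (coordProj J x)] G' ∘ fun y => coordProj J' (G y) := by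
    have hopen := hp.pairing.isOpen_image hp'.pairing.isOpen
    filter_upwards [hopen.mem_nhds ⟨x, ⟨hx, hx'.2⟩, rfl⟩] with y hy
    obtain ⟨w, ⟨hw, hw'⟩, rfl⟩ := hy
    have h1 : G (coordProj J w) = w := hp.graph_eq hw
    rw [Function.comp_apply, h1]
    exact (hp'.graph_eq ⟨hw.1, hw'⟩).symm
  have huniq := dG.unique (dC.congr_of_eventuallyEq hEq)
  exact congrArg (fun T : coordSpace J →L[ℝ] EllTwo => T (coordProj J (stdVec j))) huniq

end IsLocallyFinitePairing

/-! ### Change of coordinates -/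

theorem gaussianPDF_eq_exp_logDensity {a : ℕ → ℝ} {i : ℕ} (hi : 0 < a i) (p : EllTwo) :
    gaussianPDF 0 (Real.toNNReal (a i ^ 2)) (p i) =
      ENNReal.ofReal (Real.exp (logDensity a p i)) := by
  rw [gaussianPDF, gaussianPDFReal, logDensity, Real.coe_toNNReal _ (by positivity),
    Real.exp_sub, Real.exp_log (by positivity), Real.sqrt_mul (by positivity) (a i ^ 2),
    Real.sqrt_sq hi.le, sub_zero, one_div, neg_div, Real.exp_neg, ← div_eq_mul_inv]

/-- The Gaussian density in the exchanged coordinates completes `F_{ℕ∖J}` to `F_{ℕ∖L}`, which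
depends on the point of the surface only. -/
theorem prod_gaussianPDF_mul_density {κ : Type*} [Fintype κ] {L J : Set ℕ} {c : κ → ℕ}
    (h : IsSplitting L c J) {a : ℕ → ℝ} (ha : ∀ i, 0 < a i) {p : EllTwo} {w : coordSpace Jᶜ}
    (hw : ∀ i ∉ J, (w : EllTwo) i = p i) (hd : w ∈ densityDomain a Jᶜ) :
    (∏ k, gaussianPDF 0 (Real.toNNReal (a (c k) ^ 2)) (p (c k))) *
        ENNReal.ofReal (density a Jᶜ w) =
      ENNReal.ofReal (Real.exp (∑' i : (Lᶜ : Set ℕ), logDensity a p i)) := by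
  have hs : IsSplitting Jᶜ c Lᶜ := by
    refine ⟨h.injective, fun k hk => hk (h.right_mem k), ?_⟩
    ext i
    constructor
    · intro hi
      by_cases hJ : i ∈ J
      · exact Or.inr ((h.mem_cases hJ).resolve_left hi)
      · exact Or.inl hJ
    · rintro (hi | ⟨k, rfl⟩)
      · exact fun hL => hi (h.left_mem hL)
      · exact h.notMem k
  have hlog : ∀ i : (Jᶜ : Set ℕ), logDensity a w i = logDensity a p i := fun i => by
    rw [logDensity, logDensity, hw i i.2]
  have hsum : Summable fun i : (Jᶜ : Set ℕ) => logDensity a p i := by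
    simp only [← hlog]
    exact summable_abs_iff.1 hd
  have htsum : ∑' i : (Lᶜ : Set ℕ), logDensity a p i =
      ∑' i : (Jᶜ : Set ℕ), logDensity a p i + ∑ k, logDensity a p (c k) := by
    rw [← hs.sumEquiv.tsum_eq fun i : (Lᶜ : Set ℕ) => logDensity a p i, Summable.tsum_sum,
      ← tsum_fintype (L := .unconditional κ)]
    · rfl
    · exact hsum
    · exact (hasSum_fintype _).summable
  rw [htsum, Real.exp_add, Real.exp_sum, ENNReal.ofReal_mul (Real.exp_nonneg _), mul_comm,
    ENNReal.ofReal_prod_of_nonneg fun _ _ => Real.exp_nonneg _, density]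
  simp only [hlog, gaussianPDF_eq_exp_logDensity (ha _)]

theorem coordProj_eq_coordJoin {κ : Type*} [Fintype κ] {L J : Set ℕ} {c : κ → ℕ}
    (h : IsSplitting L c J) {p : EllTwo} {z : coordSpace L}
    (hp : ∀ i ∈ L, p i = (z : EllTwo) i) : coordProj J p = coordJoin c J z fun k => p (c k) := by
  refine coordSpace_ext_of_splitting h (fun i hi => ?_) fun k => ?_
  · rw [coordJoin_apply_left h _ _ hi, coordProj_apply_of_mem (h.left_mem hi), hp i hi]
  · rw [coordJoin_apply_right h, coordProj_apply_of_mem (h.right_mem k)]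

theorem hasFDerivAt_coordJoin {κ : Type*} [Fintype κ] {L : Set ℕ} (c : κ → ℕ) (J : Set ℕ)
    (z : coordSpace L) (u : κ → ℝ) :
    HasFDerivAt (coordJoin c J z)
      (∑ k, (ContinuousLinearMap.proj (R := ℝ) (φ := fun _ : κ => ℝ) k).smulRight
        (coordProj J (stdVec (c k)))) u := by
  have : coordJoin c J z = fun u => coordProj J (z : EllTwo) +
      (∑ k, (ContinuousLinearMap.proj (R := ℝ) (φ := fun _ : κ => ℝ) k).smulRight
        (coordProj J (stdVec (c k)))) u := by
    funext u
    simp [coordJoin]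
  rw [this]
  exact (ContinuousLinearMap.hasFDerivAt _).const_add _

section Transition

variable {κ : Type*} [Fintype κ] [DecidableEq κ] {a : ℕ → ℝ} {I L J J' : Set ℕ}
  {S U U' : Set EllTwo} {c c' : κ → ℕ} {f : coordSpace J → coordSpace Jᶜ}
  {f' : coordSpace J' → coordSpace J'ᶜ}

/-- On the fibre over `z ∈ P_L` the passage from one chart to the other is a differentiable
injective map between subsets of a Euclidean space, to which the classical change of variables
applies. -/
theorem setLIntegral_fiber_eq (ha : ∀ i, 0 < a i) (h : IsSplitting L c J)
    (h' : IsSplitting L c' J') (hp : IsLocallyFinitePairing a I S U J f)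
    (hp' : IsLocallyFinitePairing a I S U' J' f') {E : Set EllTwo} (hE : E ⊆ S ∩ U)
    (hE' : E ⊆ S ∩ U') (hm : MeasurableSet (coordProj J '' E)) (z : coordSpace L) :
    ∫⁻ u in coordJoin c J z ⁻¹' (coordProj J '' E),
        (∏ k, gaussianPDF 0 (Real.toNNReal (a (c k) ^ 2)) (u k)) *
          (areaFactor f (coordJoin c J z u) *
            ENNReal.ofReal (density a Jᶜ (f (coordJoin c J z u)))) =
      ∫⁻ v in coordJoin c' J' z ⁻¹' (coordProj J' '' E),
        (∏ k, gaussianPDF 0 (Real.toNNReal (a (c' k) ^ 2)) (v k)) *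
          (areaFactor f' (coordJoin c' J' z v) *
            ENNReal.ofReal (density a J'ᶜ (f' (coordJoin c' J' z v)))) := by
  set A := coordJoin c J z ⁻¹' (coordProj J '' E) with hA
  set ψ : (κ → ℝ) → κ → ℝ := fun u k =>
    ((coordJoin c J z u : EllTwo) + (f (coordJoin c J z u) : EllTwo) : EllTwo) (c' k) with hψ
  -- the point of the surface over `u ∈ A`
  have hpt : ∀ u ∈ A, ∃ p ∈ E, coordProj J p = coordJoin c J z u ∧
      coordProj J' p = coordJoin c' J' z (ψ u) ∧ (∀ k, u k = p (c k)) ∧ ∀ k, ψ u k = p (c' k) := by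
    rintro u ⟨p, hpE, hpu⟩
    have hψp : ∀ k, ψ u k = p (c' k) := fun k => by
      simp only [hψ, ← hpu]
      rw [hp.graph_eq (hE hpE)]
    refine ⟨p, hpE, hpu, ?_, fun k => ?_, hψp⟩
    · rw [funext hψp]
      refine coordProj_eq_coordJoin h' fun i hi => ?_
      rw [← coordProj_apply_of_mem (h.left_mem hi) p, hpu, coordJoin_apply_left h _ _ hi]
    · rw [← coordProj_apply_of_mem (h.right_mem k) p, hpu, coordJoin_apply_right h]
  have hAm : MeasurableSet A := by
    have hc : Continuous (coordJoin c J z) :=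
      continuous_coordJoin.comp (Continuous.prodMk_right z)
    exact hc.measurable hm
  have himage : ψ '' A = coordJoin c' J' z ⁻¹' (coordProj J' '' E) := by
    ext v
    constructor
    · rintro ⟨u, hu, rfl⟩
      obtain ⟨p, hpE, -, h2, -⟩ := hpt u hu
      exact ⟨p, hpE, h2⟩
    · rintro ⟨p, hpE, hpv⟩
      have hzp : ∀ i ∈ L, p i = (z : EllTwo) i := fun i hi => by
        rw [← coordProj_apply_of_mem (h'.left_mem hi) p, hpv, coordJoin_apply_left h' _ _ hi]
      have hu : (fun k => p (c k)) ∈ A := ⟨p, hpE, coordProj_eq_coordJoin h hzp⟩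
      refine ⟨_, hu, ?_⟩
      funext k
      simp only [hψ, ← coordProj_eq_coordJoin h hzp]
      rw [hp.graph_eq (hE hpE), ← coordProj_apply_of_mem (h'.right_mem k) p, hpv,
        coordJoin_apply_right h']
  have hinj : Set.InjOn ψ A := by
    intro u hu v hv huv
    obtain ⟨p, hpE, -, h2, h3, -⟩ := hpt u hu
    obtain ⟨q, hqE, -, k2, k3, -⟩ := hpt v hv
    have hpq : p = q :=
      hp'.pairing.injOn (hE' hpE) (hE' hqE) (by rw [h2, k2, huv])
    funext k
    rw [h3, k3, hpq]
  set M : (κ → ℝ) → Matrix κ κ ℝ := fun u => Matrix.of fun k l =>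
    graphFrame (fderiv ℝ f (coordJoin c J z u)) (c l) (c' k) with hM
  have hder : ∀ u ∈ A, HasFDerivWithinAt ψ (LinearMap.toContinuousLinearMap
      (Matrix.toLin' (M u))) A u := by
    intro u hu
    obtain ⟨p, hpE, h1, -⟩ := hpt u hu
    have hf := hp.hasFDerivAt (hE hpE)
    rw [h1] at hf
    set D := fderiv ℝ f (coordJoin c J z u) with hD
    have dG : HasFDerivAt (fun y : coordSpace J => ((y : EllTwo) + (f y : EllTwo) : EllTwo))
        ((coordSpace J).subtypeL + (coordSpace Jᶜ).subtypeL.comp D) (coordJoin c J z u) :=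
      (coordSpace J).subtypeL.hasFDerivAt.add
        ((coordSpace Jᶜ).subtypeL.hasFDerivAt.comp _ hf)
    have dJ := hasFDerivAt_coordJoin c J z u
    have dc := dG.comp u dJ
    refine HasFDerivAt.hasFDerivWithinAt ?_
    rw [hasFDerivAt_pi']
    intro k
    have dk := (lp.evalCLM ℝ (fun _ : ℕ => ℝ) 2 (c' k)).hasFDerivAt.comp u dc
    refine HasFDerivAt.congr_fderiv dk (ContinuousLinearMap.ext fun u' => ?_)
    set T : coordSpace J →L[ℝ] ℝ := (lp.evalCLM ℝ (fun _ : ℕ => ℝ) 2 (c' k)).comp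
      ((coordSpace J).subtypeL + (coordSpace Jᶜ).subtypeL.comp D) with hT
    have hTe : ∀ l, T (coordProj J (stdVec (c l))) = M u k l := fun l => rfl
    have hsum : (∑ l, (ContinuousLinearMap.proj (R := ℝ) (φ := fun _ : κ => ℝ) l).smulRight
        (coordProj J (stdVec (c l)))) u' = ∑ l, u' l • coordProj J (stdVec (c l)) := by simp
    refine (congrArg T hsum).trans ?_
    rw [map_sum]
    simp only [map_smul, hTe, smul_eq_mul]
    change _ = ∑ l, M u k l * u' l
    exact Finset.sum_congr rfl fun l _ => mul_comm _ _
  rw [← himage, lintegral_image_eq_lintegral_abs_det_fderiv_mul volume hAm hder hinj]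
  refine setLIntegral_congr_fun hAm fun u hu => ?_
  obtain ⟨p, hpE, h1, h2, h3, h4⟩ := hpt u hu
  have hx := hE hpE
  have hx' := hE' hpE
  have hdet : |(LinearMap.toContinuousLinearMap (Matrix.toLin' (M u))).det| =
      absMinor (fun j k => graphFrame (fderiv ℝ f (coordProj J p)) j k) c' c := by
    rw [LinearMap.det_toContinuousLinearMap, LinearMap.det_toLin', absMinor, h1]
  have harea := areaFactor_eq_mul h h' (hp.hasFDerivAt hx) (hp'.hasFDerivAt hx')
    (hp.graphFrame_eq hp' hx hx')
  have hval : ∀ {K : Set ℕ} {V : Set EllTwo} {g : coordSpace K → coordSpace Kᶜ},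
      IsLocallyFinitePairing a I S V K g → p ∈ S ∩ V → ∀ i ∉ K,
        (g (coordProj K p) : EllTwo) i = p i := by
    intro K V g hg hpV i hi
    rw [← graph_apply_of_notMem hi (coordProj K p), hg.graph_eq hpV]
  have hden := prod_gaussianPDF_mul_density h ha (hval hp hx) (hp.mem_domain _ ⟨p, hx, rfl⟩)
  have hden' := prod_gaussianPDF_mul_density h' ha (hval hp' hx') (hp'.mem_domain _ ⟨p, hx', rfl⟩)
  simp only [h3, h4]
  rw [hdet, ← h1, ← h2, mul_left_comm, hden, mul_left_comm (∏ k, _), hden', harea, mul_assoc]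

theorem localSurfaceMeasure_eq (ha : ∀ i, 0 < a i)
    (hp : IsLocallyFinitePairing a I S U J f) (hp' : IsLocallyFinitePairing a I S U' J' f')
    {E : Set S} (hE : MeasurableSet E) (hEU : Subtype.val '' E ⊆ U ∩ U') :
    localSurfaceMeasure a f (Subtype.val '' E) = localSurfaceMeasure a f' (Subtype.val '' E) := by
  obtain ⟨n, L, c₀, c, c', -, hc, hc'⟩ :=
    exists_common_splitting hp.pairing.mem_class hp'.pairing.mem_class
  have hES : Subtype.val '' E ⊆ S := by rintro _ ⟨x, -, rfl⟩; exact x.2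
  have hE₁ : Subtype.val '' E ⊆ S ∩ U := fun x hx => ⟨hES hx, (hEU hx).1⟩
  have hE₂ : Subtype.val '' E ⊆ S ∩ U' := fun x hx => ⟨hES hx, (hEU hx).2⟩
  -- the local measure as an iterated integral over `P_L` and the remaining coordinates
  have key : ∀ {K : Set ℕ} {V : Set EllTwo} {g : coordSpace K → coordSpace Kᶜ} {r : Fin n → ℕ},
      IsSplitting L r K → IsLocallyFinitePairing a I S V K g → Subtype.val '' E ⊆ S ∩ V →
      MeasurableSet (coordProj K '' (Subtype.val '' E)) ∧
      localSurfaceMeasure a g (Subtype.val '' E) = ∫⁻ z, ∫⁻ u in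
        coordJoin r K z ⁻¹' (coordProj K '' (Subtype.val '' E)),
        (∏ k, gaussianPDF 0 (Real.toNNReal (a (r k) ^ 2)) (u k)) *
          (areaFactor g (coordJoin r K z u) *
            ENNReal.ofReal (density a Kᶜ (g (coordJoin r K z u)))) ∂volume ∂gaussMeasure a L := by
    intro K V g r hr hg hV
    have hQ : MeasurableSet (coordProj K '' (Subtype.val '' E)) :=
      hg.pairing.measurableSet_image hE (hV.trans Set.inter_subset_right)
    refine ⟨hQ, ?_⟩
    rw [localSurfaceMeasure, ← lintegral_indicator hQ, lintegral_gaussMeasure_splitting hr ha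
      (hg.measurable_indicator_weight hQ (Set.image_mono hV))]
    refine lintegral_congr fun z => ?_
    have hcont : Continuous (coordJoin r K z) :=
      continuous_coordJoin.comp (Continuous.prodMk_right z)
    rw [← lintegral_indicator (hcont.measurable hQ)]
    refine lintegral_congr fun u => ?_
    by_cases hu : coordJoin r K z u ∈ coordProj K '' (Subtype.val '' E)
    · rw [Set.indicator_of_mem hu, Set.indicator_of_mem (Set.mem_preimage.2 hu)]
    · have hu' : u ∉ coordJoin r K z ⁻¹' (coordProj K '' (Subtype.val '' E)) := hu
      rw [Set.indicator_of_notMem hu, Set.indicator_of_notMem hu', mul_zero]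
  obtain ⟨hm, e₁⟩ := key hc hp hE₁
  obtain ⟨-, e₂⟩ := key hc' hp' hE₂
  rw [e₁, e₂]
  exact lintegral_congr fun z => setLIntegral_fiber_eq ha hc hc' hp hp' hE₁ hE₂ hm z

end Transition

/-! ### The surface measure -/

/-- The local surface measure of a chart over `S ∩ U` as a measure on `S`, concentrated on `U`. -/
noncomputable def chartMeasure (a : ℕ → ℝ) (S U : Set EllTwo) {J : Set ℕ}
    (f : coordSpace J → coordSpace Jᶜ) : Measure S :=
  (((gaussMeasure a J).withDensity fun y =>
    areaFactor f y * ENNReal.ofReal (density a Jᶜ (f y))).comap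
      ((S ∩ U).domRestrict (coordProj J))).map (Set.inclusion Set.inter_subset_left)

section ChartMeasure

variable {a : ℕ → ℝ} {I J : Set ℕ} {S U : Set EllTwo} {f : coordSpace J → coordSpace Jᶜ}

theorem IsLocallyFinitePairing.chartMeasure_apply (hp : IsLocallyFinitePairing a I S U J f)
    {E : Set S} (hE : MeasurableSet E) (hEU : Subtype.val '' E ⊆ U) :
    chartMeasure a S U f E = localSurfaceMeasure a f (Subtype.val '' E) := by
  have himage : (S ∩ U).domRestrict (coordProj J) '' (Set.inclusion Set.inter_subset_left ⁻¹' E) =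
      coordProj J '' (Subtype.val '' E) := by
    ext y
    constructor
    · rintro ⟨x, hx, rfl⟩
      exact ⟨_, ⟨_, hx, rfl⟩, rfl⟩
    · rintro ⟨_, ⟨x, hx, rfl⟩, rfl⟩
      exact ⟨⟨x, x.2, hEU ⟨x, hx, rfl⟩⟩, hx, rfl⟩
  rw [chartMeasure, Measure.map_apply (measurable_inclusion _) hE,
    hp.pairing.homeo.measurableEmbedding.comap_apply, himage,
    withDensity_apply _ (hp.pairing.measurableSet_image hE hEU), localSurfaceMeasure]

theorem IsLocallyFinitePairing.localSurfaceMeasure_lt_top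
    (hp : IsLocallyFinitePairing a I S U J f) {E : Set S} (hE : MeasurableSet E)
    (hEU : Subtype.val '' E ⊆ U) : localSurfaceMeasure a f (Subtype.val '' E) < ⊤ := by
  have hQ := hp.pairing.measurableSet_image hE hEU
  have hsub : coordProj J '' (Subtype.val '' E) ⊆ chartDomain S U J := by
    refine Set.image_mono ?_
    rintro _ ⟨x, hx, rfl⟩
    exact ⟨x.2, hEU ⟨x, hx, rfl⟩⟩
  refine lt_of_le_of_lt (setLIntegral_mono' hQ fun y hy =>
    le_iSup₂ (f := fun y (_ : y ∈ chartDomain S U J) =>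
      areaFactor f y * ENNReal.ofReal (density a Jᶜ (f y))) y (hsub hy)) ?_
  rw [setLIntegral_const]
  exact ENNReal.mul_lt_top hp.bounded ((gaussMeasure_le_one a J _).trans_lt ENNReal.one_lt_top)

end ChartMeasure

/-- Compatible charts glue: the local measures are restricted to a disjoint sequence of Borel sets
subordinate to a countable subcover. -/
theorem exists_surfaceMeasure {a : ℕ → ℝ} (ha : ∀ i, 0 < a i) {I : Set ℕ} {S : Set EllTwo}
    {ι : Type*} {U : ι → Set EllTwo} {J : ι → Set ℕ}
    {f : ∀ i, coordSpace (J i) → coordSpace (J i)ᶜ}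
    (hp : ∀ i, IsLocallyFinitePairing a I S (U i) (J i) (f i)) (hS : S ⊆ ⋃ i, U i) :
    ∃ μS : Measure S, SigmaFinite μS ∧
      ∀ (i : ι) (E : Set S), MeasurableSet E → Subtype.val '' E ⊆ U i →
        μS E = localSurfaceMeasure a (f i) (Subtype.val '' E) := by
  rcases isEmpty_or_nonempty ι with hι | ⟨⟨i₀⟩⟩
  · have : IsEmpty S := ⟨fun x => by simpa using hS x.2⟩
    exact ⟨0, inferInstance, fun i => hι.elim i⟩
  obtain ⟨t, ht, htU⟩ := TopologicalSpace.isOpen_iUnion_countable U fun i => (hp i).pairing.isOpen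
  obtain ⟨g, hg⟩ := (ht.insert i₀).exists_eq_range (Set.insert_nonempty _ _)
  set V : ι → Set S := fun i => Subtype.val ⁻¹' U i with hV
  have hVm : ∀ i, MeasurableSet (V i) := fun i =>
    ((hp i).pairing.isOpen.preimage continuous_subtype_val).measurableSet
  have hcover : ⋃ n, V (g n) = Set.univ := by
    refine Set.eq_univ_of_forall fun x => ?_
    have hx := hS x.2
    rw [← htU] at hx
    obtain ⟨i, hi, hxi⟩ := Set.mem_iUnion₂.1 hx
    obtain ⟨n, rfl⟩ : i ∈ Set.range g := hg ▸ Set.mem_insert_of_mem i₀ hi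
    exact Set.mem_iUnion.2 ⟨n, hxi⟩
  set D : ℕ → Set S := disjointed fun n => V (g n) with hD
  have hDm : ∀ n, MeasurableSet (D n) := fun n => .disjointed (fun n => hVm (g n)) n
  have hDU : ∀ n (E : Set S), Subtype.val '' (E ∩ D n) ⊆ U (g n) := by
    rintro n E _ ⟨x, hx, rfl⟩
    exact disjointed_subset _ n hx.2
  have hval : ∀ (i : ι) (E : Set S), MeasurableSet E → Subtype.val '' E ⊆ U i →
      (Measure.sum fun n => (chartMeasure a S (U (g n)) (f (g n))).restrict (D n)) E =
        localSurfaceMeasure a (f i) (Subtype.val '' E) := by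
    intro i E hE hEU
    have hEi : ∀ n, Subtype.val '' (E ∩ D n) ⊆ U i := fun n =>
      (Set.image_mono Set.inter_subset_left).trans hEU
    have hunion : ⋃ n, E ∩ D n = E := by
      rw [← Set.inter_iUnion, hD, iUnion_disjointed, hcover, Set.inter_univ]
    have hdisj : Pairwise (Function.onFun Disjoint fun n => E ∩ D n) := fun m n hmn =>
      (disjoint_disjointed (fun n => V (g n)) hmn).mono Set.inter_subset_right
        Set.inter_subset_right
    rw [Measure.sum_apply _ hE, ← (hp i).chartMeasure_apply hE hEU]
    conv_rhs => rw [← hunion, measure_iUnion hdisj fun n => hE.inter (hDm n)]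
    refine tsum_congr fun n => ?_
    have hEn := hE.inter (hDm n)
    rw [Measure.restrict_apply hE, (hp (g n)).chartMeasure_apply hEn (hDU n E),
      (hp i).chartMeasure_apply hEn (hEi n)]
    exact localSurfaceMeasure_eq ha (hp (g n)) (hp i) hEn (Set.subset_inter (hDU n E) (hEi n))
  refine ⟨_, ?_, hval⟩
  refine Measure.sigmaFinite_of_countable (S := Set.range fun n => V (g n))
    (Set.countable_range _) ?_ ?_
  · rintro _ ⟨n, rfl⟩
    have hsub : Subtype.val '' V (g n) ⊆ U (g n) := Set.image_preimage_subset _ _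
    rw [hval (g n) _ (hVm _) hsub]
    exact (hp (g n)).localSurfaceMeasure_lt_top (hVm _) hsub
  · rw [Set.sUnion_range, hcover]

theorem mainTheorem5 (a : ℕ → ℝ) (ha : ∀ i, 0 < a i) (hsum : Summable a)
    (I : Set ℕ) (hI : I.Nonempty) (S : Set EllTwo) (hS : IsSurface I S) :
    (∀ (U U' : Set EllTwo) (I₁ I₂ : Set ℕ)
        (f : coordSpace I₁ → coordSpace I₁ᶜ) (f' : coordSpace I₂ → coordSpace I₂ᶜ),
        IsLocallyFinitePairing a I S U I₁ f → IsLocallyFinitePairing a I S U' I₂ f' →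
        ∀ E : Set S, MeasurableSet E → Subtype.val '' E ⊆ U ∩ U' →
          localSurfaceMeasure a f (Subtype.val '' E) =
            localSurfaceMeasure a f' (Subtype.val '' E)) ∧
    (IsMeasurableSurface a I S →
      ∀ (ι : Type*) (U : ι → Set EllTwo) (J : ι → Set ℕ)
        (f : ∀ i, coordSpace (J i) → coordSpace (J i)ᶜ),
        (∀ i, IsLocallyFinitePairing a I S (U i) (J i) (f i)) → S ⊆ ⋃ i, U i →
        ∃ μS : Measure S, SigmaFinite μS ∧
          ∀ (i : ι) (E : Set S), MeasurableSet E → Subtype.val '' E ⊆ U i →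
            μS E = localSurfaceMeasure a (f i) (Subtype.val '' E)) :=
  ⟨fun _ _ _ _ _ _ hp hp' _ hE hEU => localSurfaceMeasure_eq ha hp hp' hE hEU,
    fun _ _ _ _ _ hp hcov => exists_surfaceMeasure ha hp hcov⟩
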